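/- Let $n\ge 1$ and $0<\lambda<n$. All cubes have sides parallel to the coordinate axes, and $B(x,r)$ is the open Euclidean ball. The Morrey space $\mathcal M_{1,\lambda}(\mathbb R^n)$ consists of the locally integrable functions $f$ with $$\|f\|_{\mathcal M_{1,\lambda}}=\sup_{x\in\mathbb R^n,\ r>0} r^{\lambda-n}\int_{B(x,r)}|f(y)|\,dy<\infty .$$ A real function $f$ on $\mathbb R^n$ is radially decreasing if $f(x)=\varphi(|x|)$ for $x\ne 0$ with some non-increasing $\varphi:(0,\infty)\to\mathbb R$. Let $Mf(x)=\sup_{Q\ni x}\frac1{|Q|}\int_Q|f(y)|\,dy$ be the Hardy--Littlewood maximal function, the supremum being over all cubes $Q$ containing $x$. Let $$C_b(f)(x)=\sup_{Q\ni x}\frac1{|Q|}\int_Q|b(x)-b(y)|\,|f(y)|\,dy,\qquad [M,b]f(x)=M(bf)(x)-b(x)\,Mf(x).$$ Let $b:\mathbb R^n\to\mathbb R$ be in $\mathrm{BMO}(\mathbb R^n)$, that is, $b$ is locally integrable and $\sup_Q\frac1{|Q|}\int_Q|b(y)-b_Q|\,dy<\infty$, where $b_Q=\frac1{|Q|}\int_Q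 b$. (1) The operator $C_b$ is bounded on $\mathcal M_{1,\lambda}$ for radially decreasing functions: there is a constant $C<\infty$ such that for every radially decreasing $f\in\mathcal M_{1,\lambda}$ one has $C_b(f)\in\mathcal M_{1,\lambda}$ and $\|C_b(f)\|_{\mathcal M_{1,\lambda}}\le C\|f\|_{\mathcal M_{1,\lambda}}$. (2) If in addition $b^-=\max\{-b,0\}\in L_\infty(\mathbb R^n)$, then $[M,b]$ is bounded on $\mathcal M_{1,\lambda}$ for radially decreasing functions: for every radially decreasing $f\in\mathcal M_{1,\lambda}$ the functions $Mf$ and $M(bf)$ are finite almost everywhere (so that $[M,b]f$ is defined almost everywhere), and there is a constant $C<\infty$ such that for all such $f$ one has $[M,b]f\in\mathcal M_{1,\lambda}$ and $\|[M,b]f\|_{\mathcal M_{1,\lambda}}\le C\|f\|_{\mathcal M_{1,\lambda}}$. -/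

import Mathlib

open MeasureTheory
open scoped ENNReal NNReal

/-- The open axis-parallel cube with centre `c` and side length `2 * r`. -/
def cube {n : ℕ} (c : EuclideanSpace ℝ (Fin n)) (r : ℝ) : Set (EuclideanSpace ℝ (Fin n)) :=
  {y | ∀ i, |y i - c i| < r}

/-- The uncentred Hardy-Littlewood maximal function over cubes, with values in `[0, ∞]`. -/
noncomputable def maximalFunction {n : ℕ} (f : EuclideanSpace ℝ (Fin n) → ℝ)
    (x : EuclideanSpace ℝ (Fin n)) : ℝ≥0∞ :=
  ⨆ (c : EuclideanSpace ℝ (Fin n)) (r : ℝ) (_ : 0 < r) (_ : x ∈ cube c r),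
    ⨍⁻ y in cube c r, ‖f y‖ₑ ∂volume

/-- The maximal commutator `C_b(f)`, with values in `[0, ∞]`. -/
noncomputable def maximalCommutator {n : ℕ} (b f : EuclideanSpace ℝ (Fin n) → ℝ)
    (x : EuclideanSpace ℝ (Fin n)) : ℝ≥0∞ :=
  ⨆ (c : EuclideanSpace ℝ (Fin n)) (r : ℝ) (_ : 0 < r) (_ : x ∈ cube c r),
    ⨍⁻ y in cube c r, ‖b x - b y‖ₑ * ‖f y‖ₑ ∂volume

/-- The commutator `[M, b] f = M (b f) - b * M f` of the maximal operator with `b`. It has its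
intended meaning at the points where `M (b f)` and `M f` are both finite. -/
noncomputable def commutatorOfMaximal {n : ℕ} (b f : EuclideanSpace ℝ (Fin n) → ℝ)
    (x : EuclideanSpace ℝ (Fin n)) : ℝ :=
  (maximalFunction (fun y => b y * f y) x).toReal - b x * (maximalFunction f x).toReal

/-- The BMO seminorm: the supremum over all cubes of the mean oscillation. -/
noncomputable def bmoSeminorm {n : ℕ} (b : EuclideanSpace ℝ (Fin n) → ℝ) : ℝ≥0∞ :=
  ⨆ (c : EuclideanSpace ℝ (Fin n)) (r : ℝ) (_ : 0 < r),
    ⨍⁻ y in cube c r, ‖b y - ⨍ z in cube c r, b z‖ₑ ∂volume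

/-- The class BMO. -/
def IsBMO {n : ℕ} (b : EuclideanSpace ℝ (Fin n) → ℝ) : Prop :=
  LocallyIntegrable b ∧ bmoSeminorm b < ∞

/-- The norm of the Morrey space with exponents `1` and `lam`, for real-valued functions as well
as for functions with values in `[0, ∞]`. -/
noncomputable def morreyNorm {n : ℕ} {ε : Type*} [ENorm ε] (lam : ℝ)
    (f : EuclideanSpace ℝ (Fin n) → ε) : ℝ≥0∞ :=
  ⨆ (x : EuclideanSpace ℝ (Fin n)) (r : ℝ) (_ : 0 < r),
    ENNReal.ofReal (r ^ (lam - n)) * ∫⁻ y in Metric.ball x r, ‖f y‖ₑ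

/-- Membership in the Morrey space with exponents `1` and `lam`. -/
def InMorrey {n : ℕ} {ε : Type*} [TopologicalSpace ε] [ContinuousENorm ε] (lam : ℝ)
    (f : EuclideanSpace ℝ (Fin n) → ε) : Prop :=
  LocallyIntegrable f ∧ morreyNorm lam f < ∞

/-- Radially decreasing functions: `f x = φ |x|` with `φ` non-increasing on `(0, ∞)`. The value
at the origin is unrestricted. -/
def RadiallyDecreasing {n : ℕ} (f : EuclideanSpace ℝ (Fin n) → ℝ) : Prop :=
  ∃ φ : ℝ → ℝ, AntitoneOn φ (Set.Ioi 0) ∧ ∀ x, x ≠ 0 → f x = φ ‖x‖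

/-- `T` is bounded on the Morrey space with exponents `1` and `lam` for radially decreasing
functions. -/
def BoundedOnRadiallyDecreasing {n : ℕ} {ε : Type*} [TopologicalSpace ε] [ContinuousENorm ε]
    (lam : ℝ) (T : (EuclideanSpace ℝ (Fin n) → ℝ) → EuclideanSpace ℝ (Fin n) → ε) : Prop :=
  ∃ C : ℝ≥0, ∀ f : EuclideanSpace ℝ (Fin n) → ℝ, RadiallyDecreasing f → InMorrey lam f →
    InMorrey lam (T f) ∧ morreyNorm lam (T f) ≤ C * morreyNorm lam f

/-! ### Cubes and mean values of BMO functions -/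

section Cubes

variable {n : ℕ}

/-! Monotonicity reduces everything to one function. A radially decreasing `f` of finite Morrey norm
is nonnegative off the origin, and comparing `f x` with the integral of `f` over `B(0, |x|)` gives
`f x ≤ V⁻¹ ‖f‖ |x|^(-λ)`, where `V` is the volume of the unit ball (`RadiallyDecreasing.enorm_le`).
Since `C_b` and `M` are monotone and homogeneous in `|f|`, it is enough that `C_b(w)` and `M(w)`
have finite Morrey norm for the single weight `w(x) = |x|^(-λ)`.

For `ρ ≤ |x| < 2ρ` the weight can be pulled out of averages over cubes through `x` as `ρ^(-λ)`
(`exists_lintegral_cube_mul_rpow_le`). Small cubes stay away from the origin. Large ones are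
absorbed by centred cubes, on which dyadic shells give geometric series because `0 < λ < n`; these
series tolerate the logarithmic growth of the means of `|b - α|` as the scale leaves `ρ`. With `α`
the mean of `b` at scale `ρ`, the outcome is `C_b(w)(x) ≤ C ρ^(-λ) (δ + N_ρ(x))` for almost every
`x`, where `N_ρ` is `gridDeviation`, the largest deviation from `α` of the dyadic means of `b`
around `x`. A stopping-time argument of John-Nirenberg type (`measure_lt_deviation_le`) gives `N_ρ`
exponential tails, so each of its moments over the annulus is `O(ρ^n)`.

Hence the integral of `C_b(w)^(q+1)` over the annulus is `O(ρ^(n - λ(q+1)))` for every `q`. Once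
`λ(q+1) > n`, such a bound controls the Morrey norm (`exists_morreyNorm_le_of_annulus`): for a ball
of radius `R`, the first powers sum over annuli of scale below `R` because `λ < n`, and the high
moments sum over those of larger scale. The same scheme with `1` in place of `δ + N_ρ` handles
`M(w)`. The statement on `[M, b]` follows from `|[M, b] f| ≤ C_b(f) + 2 b⁻ M f`. -/

lemma isOpen_cube (c : EuclideanSpace ℝ (Fin n)) (r : ℝ) : IsOpen (cube c r) := by
  have : cube c r = ⋂ i, {y | |y i - c i| < r} := by
    ext y; simp [cube]
  rw [this]
  exact isOpen_iInter_of_finite fun i => isOpen_lt (by fun_prop) continuous_const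

lemma measurableSet_cube (c : EuclideanSpace ℝ (Fin n)) (r : ℝ) : MeasurableSet (cube c r) :=
  (isOpen_cube c r).measurableSet

lemma cube_subset_cube {c c' : EuclideanSpace ℝ (Fin n)} {r r' : ℝ}
    (h : ∀ i, |c i - c' i| + r ≤ r') : cube c r ⊆ cube c' r' := by
  intro y hy i
  have h1 := hy i
  have h2 := h i
  have h3 := abs_sub_le (y i) (c i) (c' i)
  linarith

lemma volume_cube (c : EuclideanSpace ℝ (Fin n)) {r : ℝ} (hr : 0 < r) :
    volume (cube c r) = ENNReal.ofReal (2 * r) ^ n := by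
  have h := (EuclideanSpace.volume_preserving_symm_measurableEquiv_toLp (Fin n)).measure_preimage
    (s := Metric.ball (fun i => c i) r) Metric.isOpen_ball.measurableSet.nullMeasurableSet
  have h2 : (MeasurableEquiv.toLp 2 (Fin n → ℝ)).symm ⁻¹' (Metric.ball (fun i => c i) r)
      = cube c r := by
    ext y
    simp only [Set.mem_preimage, Metric.mem_ball, dist_pi_lt_iff hr, cube, Set.mem_ofPred_eq]
    rfl
  rw [h2, Real.volume_pi_ball _ hr, Fintype.card_fin, ENNReal.ofReal_pow (by positivity)] at h
  exact h

lemma volume_cube_ne_zero (c : EuclideanSpace ℝ (Fin n)) {r : ℝ} (hr : 0 < r) :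
    volume (cube c r) ≠ 0 := by
  rw [volume_cube c hr]
  exact pow_ne_zero _ (by simpa using hr)

lemma volume_cube_ne_top (c : EuclideanSpace ℝ (Fin n)) {r : ℝ} (hr : 0 < r) :
    volume (cube c r) ≠ ∞ := by
  rw [volume_cube c hr]
  exact ENNReal.pow_ne_top ENNReal.ofReal_ne_top

lemma volume_cube_le_mul {c c' : EuclideanSpace ℝ (Fin n)} {r r' : ℝ} (hr : 0 < r) (hr' : 0 < r')
    {K : ℝ} (h : r' ≤ K * r) :
    volume (cube c' r') ≤ ENNReal.ofReal K ^ n * volume (cube c r) := by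
  rw [volume_cube c hr, volume_cube c' hr', ← mul_pow]
  have hK : 0 ≤ K := by
    by_contra hK
    nlinarith
  gcongr
  rw [← ENNReal.ofReal_mul hK]
  exact ENNReal.ofReal_le_ofReal (by linarith)

/-- The mean value of `b` over a cube. -/
noncomputable def cubeMean (b : EuclideanSpace ℝ (Fin n) → ℝ) (c : EuclideanSpace ℝ (Fin n))
    (r : ℝ) : ℝ :=
  ⨍ z in cube c r, b z

lemma lintegral_sub_cubeMean_le (b : EuclideanSpace ℝ (Fin n) → ℝ)
    (c : EuclideanSpace ℝ (Fin n)) {r : ℝ} (hr : 0 < r) :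
    ∫⁻ y in cube c r, ‖b y - cubeMean b c r‖ₑ ≤ bmoSeminorm b * volume (cube c r) := by
  have h : ⨍⁻ y in cube c r, ‖b y - cubeMean b c r‖ₑ ∂volume ≤ bmoSeminorm b :=
    le_iSup_of_le c (le_iSup_of_le r (le_iSup_of_le hr le_rfl))
  rw [setLAverage_eq] at h
  exact (ENNReal.div_le_iff (volume_cube_ne_zero c hr) (volume_cube_ne_top c hr)).1 h

/-- Mean oscillation passes to any subset that fills a fixed proportion of the cube. This serves
dyadic cells, smaller cubes and Euclidean balls alike. -/
lemma lintegral_sub_cubeMean_le_of_subset (b : EuclideanSpace ℝ (Fin n) → ℝ)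
    {c : EuclideanSpace ℝ (Fin n)} {r : ℝ} (hr : 0 < r) {S : Set (EuclideanSpace ℝ (Fin n))}
    (hS : S ⊆ cube c r) {K : ℝ≥0∞} (hK : volume (cube c r) ≤ K * volume S) :
    ∫⁻ y in S, ‖b y - cubeMean b c r‖ₑ ≤ K * bmoSeminorm b * volume S := by
  calc _ ≤ ∫⁻ y in cube c r, ‖b y - cubeMean b c r‖ₑ := lintegral_mono_set hS
    _ ≤ bmoSeminorm b * volume (cube c r) := lintegral_sub_cubeMean_le b c hr
    _ ≤ bmoSeminorm b * (K * volume S) := by gcongr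
    _ = _ := by ring

/-- Average the triangle inequality `|u - v| ≤ |b - u| + |b - v|` over `S`. Every comparison of two
means of `b` below is made this way, on a set common to both cubes. -/
lemma enorm_sub_le_of_lintegral_le {α : Type*} [MeasurableSpace α] {μ : Measure α} {b : α → ℝ}
    (hb : AEMeasurable b μ) {S : Set α} (h0 : μ S ≠ 0) (hT : μ S ≠ ∞) {u v : ℝ} {K L : ℝ≥0∞}
    (hu : ∫⁻ y in S, ‖b y - u‖ₑ ∂μ ≤ K * μ S) (hv : ∫⁻ y in S, ‖b y - v‖ₑ ∂μ ≤ L * μ S) :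
    ‖u - v‖ₑ ≤ K + L := by
  have h : ‖u - v‖ₑ * μ S ≤ (K + L) * μ S := by
    calc ‖u - v‖ₑ * μ S = ∫⁻ _ in S, ‖u - v‖ₑ ∂μ := by simp
      _ ≤ ∫⁻ y in S, (‖b y - u‖ₑ + ‖b y - v‖ₑ) ∂μ := by
        refine lintegral_mono fun y => ?_
        have : u - v = (b y - v) - (b y - u) := by ring
        rw [this, add_comm]
        exact enorm_sub_le
      _ = ∫⁻ y in S, ‖b y - u‖ₑ ∂μ + ∫⁻ y in S, ‖b y - v‖ₑ ∂μ :=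
        lintegral_add_left' (hb.restrict.sub_const u).enorm _
      _ ≤ _ := by rw [add_mul]; gcongr
  exact (ENNReal.mul_le_mul_iff_left h0 hT).1 h

lemma enorm_cubeMean_sub_cubeMean_le {b : EuclideanSpace ℝ (Fin n) → ℝ}
    (hb : AEMeasurable b volume) {c c' : EuclideanSpace ℝ (Fin n)} {r r' : ℝ} (hr : 0 < r)
    (hr' : 0 < r') (hsub : cube c r ⊆ cube c' r') {K : ℝ} (hK : r' ≤ K * r) :
    ‖cubeMean b c r - cubeMean b c' r'‖ₑ ≤ (1 + ENNReal.ofReal K ^ n) * bmoSeminorm b := by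
  rw [add_mul, one_mul]
  exact enorm_sub_le_of_lintegral_le hb (volume_cube_ne_zero c hr) (volume_cube_ne_top c hr)
    (lintegral_sub_cubeMean_le b c hr)
    (lintegral_sub_cubeMean_le_of_subset b hr' hsub (volume_cube_le_mul hr hr' hK))

end Cubes

/-! ### John-Nirenberg inequality for nested partitions -/

/-- The John-Nirenberg inequality for a nested sequence of countable partitions: the partition of
level `m` consists of the fibres of `L m`, and `a m i` plays the role of the mean of `b` over the
fibre of `i`. -/
theorem measure_lt_deviation_le {α ι : Type*} [MeasurableSpace α] [Countable ι] {μ : Measure α}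
    {L : ℕ → α → ι} (hL : ∀ m i, MeasurableSet (L m ⁻¹' {i}))
    (hnest : ∀ m x y, L (m + 1) x = L (m + 1) y → L m x = L m y)
    (hfin : ∀ m i, μ (L m ⁻¹' {i}) ≠ ∞) {a : ℕ → ι → ℝ} {b : α → ℝ} (hb : AEMeasurable b μ)
    {δ : ℝ≥0∞} (hδ0 : δ ≠ 0) (hδT : δ ≠ ∞)
    (hstep : ∀ m x, ‖a (m + 1) (L (m + 1) x) - a m (L m x)‖ₑ ≤ δ)
    (hosc : ∀ m i, ∫⁻ y in L m ⁻¹' {i}, ‖b y - a m i‖ₑ ∂μ ≤ δ * μ (L m ⁻¹' {i})) (j : ℕ) :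
    ∀ m i, μ {y | L m y = i ∧ ∃ k, m ≤ k ∧ j * (4 * δ) < ‖a k (L k y) - a m i‖ₑ}
      ≤ 2⁻¹ ^ j * μ (L m ⁻¹' {i}) := by
  have hnest' : ∀ k m, m ≤ k → ∀ x y, L k x = L k y → L m x = L m y := by
    intro k m hmk
    induction hmk with
    | refl => exact fun x y h => h
    | step _ ih => exact fun x y h => ih x y (hnest _ x y h)
  induction j with
  | zero =>
    intro m i
    simp only [pow_zero, one_mul]
    exact measure_mono fun y hy => hy.1
  | succ j ih =>
    intro m i
    -- `S (k, l)` is the fibre of `l` at level `k` if the deviation exceeds `3 * δ` on it for the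
    -- first time at level `k`.
    let P : ℕ → α → Prop := fun k y =>
      L m y = i ∧ m ≤ k ∧ 3 * δ < ‖a k (L k y) - a m i‖ₑ ∧
        ∀ k', m ≤ k' → k' < k → ‖a k' (L k' y) - a m i‖ₑ ≤ 3 * δ
    -- By nesting, the label at level `k` determines all earlier labels, so stopping at level `k` is
    -- constant on fibres and each `S q` is empty or a whole fibre.
    have hPcongr : ∀ k y z, L k y = L k z → P k y → P k z := by
      rintro k y z hyz ⟨h1, h2, h3, h4⟩
      refine ⟨by rw [← hnest' k m h2 y z hyz, h1], h2, by rw [← hyz]; exact h3, ?_⟩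
      intro k' hk' hk'k
      rw [← hnest' k k' hk'k.le y z hyz]
      exact h4 k' hk' hk'k
    let S : ℕ × ι → Set α := fun q => {y | L q.1 y = q.2 ∧ P q.1 y}
    have hScase : ∀ q, (S q).Nonempty → S q = L q.1 ⁻¹' {q.2} := by
      rintro ⟨k, l⟩ ⟨y, hy1, hy2⟩
      ext z
      simp only [S, Set.mem_ofPred_eq, Set.mem_preimage, Set.mem_singleton_iff]
      refine ⟨fun h => h.1, fun h => ⟨h, hPcongr k y z (hy1.trans h.symm) hy2⟩⟩
    have hSmeas : ∀ q, MeasurableSet (S q) := by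
      intro q
      rcases (S q).eq_empty_or_nonempty with h | h
      · rw [h]; exact MeasurableSet.empty
      · rw [hScase q h]; exact hL _ _
    have hSdisj : Pairwise (Function.onFun Disjoint S) := by
      rintro ⟨k, l⟩ ⟨k', l'⟩ hne
      refine Set.disjoint_left.2 ?_
      rintro y ⟨h1, hp1, hp2, hp3, hp4⟩ ⟨h1', hq1, hq2, hq3, hq4⟩
      simp only at h1 h1' hp2 hp3 hp4 hq2 hq3 hq4
      apply hne
      have hkk : k = k' := by
        rcases lt_trichotomy k k' with h | h | h
        · exact absurd hp3 (not_lt.2 (hq4 k hp2 h))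
        · exact h
        · exact absurd hq3 (not_lt.2 (hp4 k' hq2 h))
      subst hkk
      rw [← h1, ← h1']
    have hSsub : ⋃ q, S q ⊆ L m ⁻¹' {i} := by
      refine Set.iUnion_subset fun q y hy => hy.2.1
    -- the total measure of the stopped fibres
    have hStotal : 2 * ∑' q, μ (S q) ≤ μ (L m ⁻¹' {i}) := by
      -- On a stopped fibre the mean is at least `3δ` away from `a m i`, while `b` is within `δ` of
      -- that mean on average; `2δ` is left over. Against the total oscillation `δ` this yields the
      -- factor `1/2` gained at each induction step.
      have h1 : ∀ q, 2 * δ * μ (S q) ≤ ∫⁻ y in S q, ‖b y - a m i‖ₑ ∂μ := by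
        rintro ⟨k, l⟩
        rcases (S (k, l)).eq_empty_or_nonempty with h | h
        · simp [h]
        have hfinS : μ (S (k, l)) ≠ ∞ := by rw [hScase _ h]; exact hfin _ _
        have hdev : 3 * δ ≤ ‖a k l - a m i‖ₑ := by
          obtain ⟨y, hy1, -, -, hy3, -⟩ := h
          simp only at hy1 hy3
          rw [← hy1]; exact hy3.le
        have h2 : 3 * δ * μ (S (k, l)) ≤
            ∫⁻ y in S (k, l), ‖b y - a m i‖ₑ ∂μ + δ * μ (S (k, l)) := by
          calc 3 * δ * μ (S (k, l)) ≤ ∫⁻ _ in S (k, l), ‖a k l - a m i‖ₑ ∂μ := by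
                rw [setLIntegral_const]; gcongr
            _ ≤ ∫⁻ y in S (k, l), (‖b y - a m i‖ₑ + ‖b y - a k l‖ₑ) ∂μ := by
                refine lintegral_mono fun y => ?_
                have : a k l - a m i = (b y - a m i) - (b y - a k l) := by ring
                rw [this]
                exact enorm_sub_le
            _ = ∫⁻ y in S (k, l), ‖b y - a m i‖ₑ ∂μ + ∫⁻ y in S (k, l), ‖b y - a k l‖ₑ ∂μ :=
                lintegral_add_left' (hb.restrict.sub_const _).enorm _
            _ ≤ _ := by
                gcongr
                rw [hScase _ h]
                exact hosc k l
        have h3 : 3 * δ * μ (S (k, l)) = 2 * δ * μ (S (k, l)) + δ * μ (S (k, l)) := by ring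
        rw [h3] at h2
        exact (ENNReal.add_le_add_iff_right (ENNReal.mul_ne_top hδT hfinS)).1 h2
      have h2 : δ * (2 * ∑' q, μ (S q)) ≤ δ * μ (L m ⁻¹' {i}) := by
        calc δ * (2 * ∑' q, μ (S q)) = ∑' q, 2 * δ * μ (S q) := by
              rw [ENNReal.tsum_mul_left]; ring
          _ ≤ ∑' q, ∫⁻ y in S q, ‖b y - a m i‖ₑ ∂μ := ENNReal.tsum_le_tsum h1
          _ = ∫⁻ y in ⋃ q, S q, ‖b y - a m i‖ₑ ∂μ := (lintegral_iUnion hSmeas hSdisj _).symm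
          _ ≤ ∫⁻ y in L m ⁻¹' {i}, ‖b y - a m i‖ₑ ∂μ := lintegral_mono_set hSsub
          _ ≤ _ := hosc m i
      exact (ENNReal.mul_le_mul_iff_right hδ0 hδT).1 h2
    have hcover : {y | L m y = i ∧ ∃ k, m ≤ k ∧
          ((j + 1 : ℕ) : ℝ≥0∞) * (4 * δ) < ‖a k (L k y) - a m i‖ₑ} ⊆
        ⋃ q : ℕ × ι, S q ∩ {y | L q.1 y = q.2 ∧ ∃ k, q.1 ≤ k ∧
          j * (4 * δ) < ‖a k (L k y) - a q.1 q.2‖ₑ} := by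
      rintro y ⟨hy, k, hmk, hk⟩
      have h34 : 3 * δ ≤ ((j + 1 : ℕ) : ℝ≥0∞) * (4 * δ) := by
        calc 3 * δ ≤ 4 * δ := by gcongr; norm_num
          _ = 1 * (4 * δ) := (one_mul _).symm
          _ ≤ _ := by gcongr; push_cast; exact le_add_self
      classical
      have hex : ∃ k, m ≤ k ∧ 3 * δ < ‖a k (L k y) - a m i‖ₑ := ⟨k, hmk, h34.trans_lt hk⟩
      obtain ⟨hτ1, hτ2⟩ := Nat.find_spec hex
      have hτmin : ∀ k', m ≤ k' → k' < Nat.find hex → ‖a k' (L k' y) - a m i‖ₑ ≤ 3 * δ := by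
        intro k' h1 h2
        have := Nat.find_min hex h2
        simpa [h1] using this
      generalize Nat.find hex = τ at hτ1 hτ2 hτmin
      have hτk : τ ≤ k := by
        by_contra h
        exact absurd (hτmin k hmk (not_le.1 h)) (not_le.2 (h34.trans_lt hk))
      -- One step before stopping the deviation was at most `3δ`, and a step adds at most `δ`. So a
      -- deviation above `4(j+1)δ` leaves more than `4jδ` to be gained after the stopping level,
      -- which is what the induction hypothesis measures.
      have hτup : ‖a τ (L τ y) - a m i‖ₑ ≤ 4 * δ := by
        rcases hτ1.eq_or_lt with h | h
        · subst h; simp [hy]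
        · obtain ⟨τ', rfl⟩ : ∃ τ', τ = τ' + 1 := ⟨τ - 1, by omega⟩
          have h1 := hτmin τ' (by omega) (by omega)
          have h2 := hstep τ' y
          have h3 : a (τ' + 1) (L (τ' + 1) y) - a m i =
            (a (τ' + 1) (L (τ' + 1) y) - a τ' (L τ' y)) + (a τ' (L τ' y) - a m i) := by ring
          rw [h3]
          calc _ ≤ δ + 3 * δ := (enorm_add_le _ _).trans (add_le_add h2 h1)
            _ = 4 * δ := by ring
      refine Set.mem_iUnion.2 ⟨(τ, L τ y), ⟨rfl, hy, hτ1, hτ2, hτmin⟩, rfl, k, hτk, ?_⟩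
      by_contra hcon
      rw [not_lt] at hcon
      have h3 : a k (L k y) - a m i =
        (a k (L k y) - a τ (L τ y)) + (a τ (L τ y) - a m i) := by ring
      rw [h3] at hk
      refine absurd (hk.trans_le ((enorm_add_le _ _).trans (add_le_add hcon hτup))) ?_
      push_cast
      rw [add_mul, one_mul]
      exact lt_irrefl _
    calc _ ≤ μ (⋃ q : ℕ × ι, S q ∩ {y | L q.1 y = q.2 ∧ ∃ k, q.1 ≤ k ∧
          j * (4 * δ) < ‖a k (L k y) - a q.1 q.2‖ₑ}) := measure_mono hcover
      _ ≤ ∑' q : ℕ × ι, μ (S q ∩ {y | L q.1 y = q.2 ∧ ∃ k, q.1 ≤ k ∧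
          j * (4 * δ) < ‖a k (L k y) - a q.1 q.2‖ₑ}) := measure_iUnion_le _
      _ ≤ ∑' q : ℕ × ι, 2⁻¹ ^ j * μ (S q) := by
          refine ENNReal.tsum_le_tsum fun q => ?_
          rcases (S q).eq_empty_or_nonempty with h | h
          · simp [h]
          · rw [hScase q h]
            exact (measure_mono Set.inter_subset_right).trans (ih q.1 q.2)
      _ = 2⁻¹ ^ j * ∑' q, μ (S q) := ENNReal.tsum_mul_left
      _ = 2⁻¹ ^ (j + 1) * (2 * ∑' q, μ (S q)) := by
          rw [pow_succ, mul_assoc, ← mul_assoc 2⁻¹ 2, ENNReal.inv_mul_cancel two_ne_zero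
            ENNReal.ofNat_ne_top, one_mul]
      _ ≤ _ := by gcongr

/-- Exponential tails give finite moments of the maximal deviation. -/
theorem lintegral_iSup_deviation_pow_le {α ι : Type*} [MeasurableSpace α] [Countable ι]
    {μ : Measure α} {L : ℕ → α → ι} (hL : ∀ m i, MeasurableSet (L m ⁻¹' {i}))
    (hnest : ∀ m x y, L (m + 1) x = L (m + 1) y → L m x = L m y)
    (hfin : ∀ m i, μ (L m ⁻¹' {i}) ≠ ∞) {a : ℕ → ι → ℝ} {b : α → ℝ} (hb : AEMeasurable b μ)
    {δ : ℝ≥0∞} (hδ0 : δ ≠ 0) (hδT : δ ≠ ∞)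
    (hstep : ∀ m x, ‖a (m + 1) (L (m + 1) x) - a m (L m x)‖ₑ ≤ δ)
    (hosc : ∀ m i, ∫⁻ y in L m ⁻¹' {i}, ‖b y - a m i‖ₑ ∂μ ≤ δ * μ (L m ⁻¹' {i})) (p : ℕ) (i : ι) :
    ∫⁻ y in L 0 ⁻¹' {i}, (δ + ⨆ k, ‖a k (L k y) - a 0 i‖ₑ) ^ p ∂μ ≤
      (∑' j : ℕ, (4 * δ * (j + 2)) ^ p * 2⁻¹ ^ j) * μ (L 0 ⁻¹' {i}) := by
  set X : α → ℝ≥0∞ := fun y => ⨆ k, ‖a k (L k y) - a 0 i‖ₑ with hX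
  -- For `j = 0` the whole fibre is taken, since the condition `0 < X y` would lose the points
  -- without deviation.
  let F : ℕ → Set α := fun j => {y | L 0 y = i ∧ (j = 0 ∨ j * (4 * δ) < X y)}
  have hF : ∀ j, μ (F j) ≤ 2⁻¹ ^ j * μ (L 0 ⁻¹' {i}) := by
    intro j
    rcases Nat.eq_zero_or_pos j with rfl | hj
    · simp only [pow_zero, one_mul]
      exact measure_mono fun y hy => hy.1
    · refine le_trans (measure_mono ?_)
        (measure_lt_deviation_le hL hnest hfin hb hδ0 hδT hstep hosc j 0 i)
      rintro y ⟨h1, h2⟩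
      obtain ⟨k, hk⟩ := lt_iSup_iff.1 (h2.resolve_left hj.ne')
      exact ⟨h1, k, Nat.zero_le k, hk⟩
  -- Layer-cake decomposition: a point in the `j`-th layer is paid for by the `j`-th term.
  -- Measurable hulls make it unnecessary to know that `F j` is measurable.
  have hpt : ∀ y ∈ L 0 ⁻¹' {i}, (δ + X y) ^ p ≤
      ∑' j : ℕ, (toMeasurable μ (F j)).indicator (fun _ => (4 * δ * (j + 2)) ^ p) y := by
    intro y hy
    by_cases hex : ∃ j : ℕ, X y ≤ ((j + 1 : ℕ) : ℝ≥0∞) * (4 * δ)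
    · classical
      have h1 := Nat.find_spec hex
      have h2 : ∀ k, k < Nat.find hex → _ := fun k hk => Nat.find_min hex hk
      generalize Nat.find hex = j at h1 h2
      have hj : y ∈ F j := by
        refine ⟨hy, ?_⟩
        rcases Nat.eq_zero_or_pos j with rfl | hj
        · exact Or.inl rfl
        · right
          have := h2 (j - 1) (by omega)
          rwa [Nat.sub_add_cancel hj, not_le] at this
      refine le_trans ?_ (ENNReal.le_tsum j)
      rw [Set.indicator_of_mem (subset_toMeasurable _ _ hj)]
      gcongr
      calc δ + X y ≤ 4 * δ + ((j + 1 : ℕ) : ℝ≥0∞) * (4 * δ) := by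
            gcongr
            calc δ = 1 * δ := (one_mul _).symm
              _ ≤ 4 * δ := by gcongr; norm_num
        _ = 4 * δ * (j + 2) := by push_cast; ring
    -- Here `X y` is infinite and `y` lies in every `F j`; the series diverges because all its terms
    -- are at least `δ ^ p`, which is nonzero.
    · push Not at hex
      have hmem : ∀ j, y ∈ F j := by
        intro j
        refine ⟨hy, Or.inr (lt_of_le_of_lt ?_ (hex j))⟩
        gcongr
        exact Nat.le_succ j
      have htop : ∑' j : ℕ, (toMeasurable μ (F j)).indicator
          (fun _ => (4 * δ * (j + 2)) ^ p) y = ∞ := by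
        rw [← top_le_iff, ← ENNReal.tsum_const_eq_top_of_ne_zero (α := ℕ) (pow_ne_zero p hδ0)]
        refine ENNReal.tsum_le_tsum fun j => ?_
        rw [Set.indicator_of_mem (subset_toMeasurable _ _ (hmem j))]
        gcongr
        calc δ = 1 * δ * 1 := by ring
          _ ≤ 4 * δ * (j + 2) := by
            gcongr
            · norm_num
            · exact le_add_left (by norm_num)
      rw [htop]
      exact le_top
  calc _ ≤ ∫⁻ y in L 0 ⁻¹' {i}, ∑' j : ℕ,
        (toMeasurable μ (F j)).indicator (fun _ => (4 * δ * (j + 2)) ^ p) y ∂μ :=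
        setLIntegral_mono' (hL 0 i) hpt
    _ ≤ ∫⁻ y, ∑' j : ℕ,
        (toMeasurable μ (F j)).indicator (fun _ => (4 * δ * (j + 2)) ^ p) y ∂μ :=
        setLIntegral_le_lintegral _ _
    _ = ∑' j : ℕ, (4 * δ * (j + 2)) ^ p * μ (F j) := by
        rw [lintegral_tsum fun j =>
          (measurable_const.indicator (measurableSet_toMeasurable _ _)).aemeasurable]
        simp_rw [lintegral_indicator_const (measurableSet_toMeasurable _ _), measure_toMeasurable]
    _ ≤ ∑' j : ℕ, (4 * δ * (j + 2)) ^ p * 2⁻¹ ^ j * μ (L 0 ⁻¹' {i}) := by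
        refine ENNReal.tsum_le_tsum fun j => ?_
        exact (mul_le_mul' le_rfl (hF j)).trans_eq (by ring)
    _ = _ := ENNReal.tsum_mul_right

lemma tsum_linear_pow_mul_geometric_ne_top {δ : ℝ≥0∞} (hδ : δ ≠ ∞) (p : ℕ) :
    ∑' j : ℕ, (4 * δ * (j + 2)) ^ p * 2⁻¹ ^ j ≠ ∞ := by
  have h1 : Summable fun j : ℕ => ((j + 2 : ℕ) : ℝ) ^ p * (1 / 2 : ℝ) ^ (j + 2) :=
    (summable_nat_add_iff (f := fun j : ℕ => (j : ℝ) ^ p * (1 / 2 : ℝ) ^ j) 2).2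
      (summable_pow_mul_geometric_of_norm_lt_one p (by norm_num))
  have h2 := (h1.mul_left 4).tsum_ofReal_ne_top
  have h3 : ∀ j : ℕ, (4 * δ * (j + 2)) ^ p * 2⁻¹ ^ j = (4 * δ) ^ p *
      ENNReal.ofReal (4 * (((j + 2 : ℕ) : ℝ) ^ p * (1 / 2 : ℝ) ^ (j + 2))) := by
    intro j
    have e1 : (4 : ℝ) * (((j + 2 : ℕ) : ℝ) ^ p * (1 / 2 : ℝ) ^ (j + 2)) =
        ((j + 2 : ℕ) : ℝ) ^ p * (2⁻¹) ^ j := by ring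
    rw [e1, ENNReal.ofReal_mul (by positivity), ENNReal.ofReal_pow (by positivity),
      ENNReal.ofReal_pow (by positivity), ENNReal.ofReal_natCast, ENNReal.ofReal_inv_of_pos two_pos,
      ENNReal.ofReal_ofNat, mul_pow]
    push_cast
    ring
  simp_rw [h3]
  rw [ENNReal.tsum_mul_left]
  exact ENNReal.mul_ne_top (ENNReal.pow_ne_top (ENNReal.mul_ne_top (by norm_num) hδ)) h2

/-! ### Averages against the weight `|y|^(-λ)` -/

section PowerWeight

variable {n : ℕ}

lemma nontrivial_of_pos_lt {lam : ℝ} (hlam0 : 0 < lam) (hlamn : lam < n) :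
    Nontrivial (EuclideanSpace ℝ (Fin n)) := by
  have : 0 < n := by exact_mod_cast hlam0.trans hlamn
  have : Nonempty (Fin n) := ⟨⟨0, this⟩⟩
  infer_instance

lemma tsum_one_add_mul_geometric_ne_top {θ : ℝ} (h0 : 0 ≤ θ) (h1 : θ < 1) :
    ∑' j : ℕ, ENNReal.ofReal ((1 + j) * θ ^ j) ≠ ∞ := by
  refine Summable.tsum_ofReal_ne_top ?_
  have h := (summable_geometric_of_lt_one h0 h1).add
    (summable_pow_mul_geometric_of_norm_lt_one 1 (r := θ) (by rwa [Real.norm_of_nonneg h0]))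
  refine h.congr fun j => ?_
  ring

lemma norm_le_mul_of_abs_le (z : EuclideanSpace ℝ (Fin n)) {t : ℝ} (ht : 0 ≤ t)
    (h : ∀ i, |z i| ≤ t) : ‖z‖ ≤ n * t := by
  have h1 : ‖z‖ ^ 2 ≤ (n * t) ^ 2 := by
    rw [EuclideanSpace.norm_sq_eq]
    calc ∑ i, ‖z i‖ ^ 2 ≤ ∑ _i : Fin n, t ^ 2 := by
          refine Finset.sum_le_sum fun i _ => ?_
          rw [Real.norm_eq_abs]
          exact pow_le_pow_left₀ (abs_nonneg _) (h i) 2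
      _ = n * t ^ 2 := by simp
      _ ≤ (n : ℝ) ^ 2 * t ^ 2 := by
          gcongr
          exact_mod_cast Nat.le_self_pow two_ne_zero n
      _ = _ := by ring
  exact (abs_le_of_sq_le_sq' h1 (by positivity)).2

lemma abs_apply_le_norm (z : EuclideanSpace ℝ (Fin n)) (i : Fin n) : |z i| ≤ ‖z‖ := by
  simpa using PiLp.norm_apply_le z i

lemma cube_zero_subset_shells (R : ℝ) :
    cube (0 : EuclideanSpace ℝ (Fin n)) R ⊆ {0} ∪ ⋃ j : ℕ,
      cube (0 : EuclideanSpace ℝ (Fin n)) (R * 2 ^ (-(j : ℤ))) \ cube 0 (R * 2 ^ (-(j : ℤ) - 1)) := by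
  intro y hy
  by_cases h0 : y = 0
  · exact Or.inl h0
  right
  have hR : 0 < R ∨ n = 0 := by
    rcases Nat.eq_zero_or_pos n with h | h
    · exact Or.inr h
    · left
      have := hy ⟨0, h⟩
      exact (abs_nonneg _).trans_lt this
  rcases hR with hR | rfl
  swap
  · exact absurd (Subsingleton.elim y 0) h0
  have hex : ∃ j : ℕ, y ∉ cube (0 : EuclideanSpace ℝ (Fin n)) (R * 2 ^ (-(j : ℤ) - 1)) := by
    by_contra hcon
    push Not at hcon
    apply h0
    ext i
    by_contra hi
    have hpos : 0 < |y i| := abs_pos.2 hi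
    obtain ⟨j, hj⟩ := exists_pow_lt_of_lt_one (div_pos hpos hR) (y := (1 / 2 : ℝ)) (by norm_num)
    have h1 := hcon j i
    simp only [PiLp.zero_apply, sub_zero] at h1
    have h2 : R * 2 ^ (-(j : ℤ) - 1) ≤ |y i| := by
      rw [lt_div_iff₀ hR] at hj
      calc R * 2 ^ (-(j : ℤ) - 1) ≤ R * 2 ^ (-(j : ℤ)) := by
            gcongr
            · norm_num
            · linarith
        _ = (1 / 2) ^ j * R := by simp [mul_comm]
        _ ≤ _ := hj.le
    linarith
  classical
  have h1 := Nat.find_spec hex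
  have h2 : ∀ k, k < Nat.find hex → _ := fun k hk => Nat.find_min hex hk
  generalize Nat.find hex = j at h1 h2
  refine Set.mem_iUnion.2 ⟨j, ?_, h1⟩
  rcases Nat.eq_zero_or_pos j with rfl | hj
  · simpa using hy
  · have h3 := h2 (j - 1) (by omega)
    rw [not_not] at h3
    have : (-((j - 1 : ℕ) : ℤ) - 1) = -(j : ℤ) := by omega
    rwa [this] at h3

/-- The weight on the `j`-th shell times the relative volume of that shell separates into a factor
geometric in `i` of ratio `2^(-λ)` and one geometric in `j` of ratio `2^(λ-n)`. Both ratios are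
below `1` when `0 < λ < n`. -/
lemma rpow_shell_identity {ρ lam : ℝ} (hρ : 0 < ρ) (i j : ℕ) :
    (ρ * 2 ^ (i : ℤ) * 2 ^ (-(j : ℤ) - 1)) ^ (-lam) * ((2 : ℝ) ^ (-(j : ℤ))) ^ n =
      ρ ^ (-lam) * ((2 : ℝ) ^ (-lam)) ^ i * 2 ^ lam * ((2 : ℝ) ^ (lam - n)) ^ j := by
  rw [mul_assoc, Real.mul_rpow hρ.le (by positivity), ← zpow_add₀ two_ne_zero]
  simp only [← Real.rpow_natCast, ← Real.rpow_intCast, ← Real.rpow_mul zero_le_two]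
  rw [mul_assoc, mul_assoc, mul_assoc, ← Real.rpow_add two_pos, ← Real.rpow_add two_pos,
    ← Real.rpow_add two_pos]
  congr 2
  push_cast
  ring

lemma rpow_le_of_notMem_cube {lam : ℝ} (hlam0 : 0 < lam) {s : ℝ} (hs : 0 < s)
    {y : EuclideanSpace ℝ (Fin n)} (hy : y ∉ cube 0 s) : ‖y‖ ^ (-lam) ≤ s ^ (-lam) := by
  have : ∃ i, s ≤ |y i| := by
    by_contra h
    push Not at h
    exact hy fun i => by simpa using h i
  obtain ⟨i, hi⟩ := this
  exact Real.rpow_le_rpow_of_nonpos hs (hi.trans (abs_apply_le_norm y i)) (by linarith)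

/-- Averages over large centred cubes against a power weight. -/
lemma exists_lintegral_cube_zero_mul_rpow_le {lam : ℝ} (hlam0 : 0 < lam) (hlamn : lam < n) :
    ∃ C : ℝ≥0∞, C ≠ ∞ ∧ ∀ ρ : ℝ, 0 < ρ → ∀ (h : EuclideanSpace ℝ (Fin n) → ℝ≥0∞) (D : ℝ≥0∞),
      (∀ l : ℤ, ∫⁻ y in cube 0 (ρ * 2 ^ l), h y ≤
        D * (1 + (l.natAbs : ℝ≥0∞)) * volume (cube (0 : EuclideanSpace ℝ (Fin n)) (ρ * 2 ^ l))) →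
      ∀ i : ℕ, ∫⁻ y in cube 0 (ρ * 2 ^ (i : ℤ)), h y * ENNReal.ofReal (‖y‖ ^ (-lam)) ≤
        C * D * ENNReal.ofReal (ρ ^ (-lam)) *
          volume (cube (0 : EuclideanSpace ℝ (Fin n)) (ρ * 2 ^ (i : ℤ))) := by
  have := nontrivial_of_pos_lt hlam0 hlamn
  set θ₁ : ℝ := 2 ^ (-lam) with hθ₁
  set θ₂ : ℝ := 2 ^ (lam - n) with hθ₂
  have h10 : 0 ≤ θ₁ := by positivity
  have h20 : 0 ≤ θ₂ := by positivity
  have h11 : θ₁ < 1 := Real.rpow_lt_one_of_one_lt_of_neg one_lt_two (by linarith)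
  have h21 : θ₂ < 1 := Real.rpow_lt_one_of_one_lt_of_neg one_lt_two (by linarith)
  set S₁ := ∑' j : ℕ, ENNReal.ofReal ((1 + j) * θ₁ ^ j) with hS₁
  set S₂ := ∑' j : ℕ, ENNReal.ofReal ((1 + j) * θ₂ ^ j) with hS₂
  refine ⟨S₁ * (ENNReal.ofReal (2 ^ lam) * S₂), ?_, ?_⟩
  · exact ENNReal.mul_ne_top (tsum_one_add_mul_geometric_ne_top h10 h11)
      (ENNReal.mul_ne_top ENNReal.ofReal_ne_top (tsum_one_add_mul_geometric_ne_top h20 h21))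
  intro ρ hρ h D hD i
  set R : ℝ := ρ * 2 ^ (i : ℤ) with hR
  have hR0 : 0 < R := by positivity
  set V := volume (cube (0 : EuclideanSpace ℝ (Fin n)) R) with hV
  set T : ℕ → Set (EuclideanSpace ℝ (Fin n)) := fun j =>
    cube 0 (R * 2 ^ (-(j : ℤ))) \ cube 0 (R * 2 ^ (-(j : ℤ) - 1)) with hT
  have hTj : ∀ j, ∫⁻ y in T j, h y * ENNReal.ofReal (‖y‖ ^ (-lam)) ≤
      D * ENNReal.ofReal (ρ ^ (-lam)) * ENNReal.ofReal ((1 + i) * θ₁ ^ i) *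
        (ENNReal.ofReal (2 ^ lam) * ENNReal.ofReal ((1 + j) * θ₂ ^ j)) * V := by
    intro j
    have hlow : 0 < R * 2 ^ (-(j : ℤ) - 1) := by positivity
    have e1 : R * 2 ^ (-(j : ℤ)) = ρ * 2 ^ ((i : ℤ) - j) := by
      rw [hR, mul_assoc, ← zpow_add₀ two_ne_zero, sub_eq_add_neg]
    calc ∫⁻ y in T j, h y * ENNReal.ofReal (‖y‖ ^ (-lam))
        ≤ ∫⁻ y in T j, h y * ENNReal.ofReal ((R * 2 ^ (-(j : ℤ) - 1)) ^ (-lam)) := by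
          refine setLIntegral_mono' ((measurableSet_cube _ _).diff (measurableSet_cube _ _)) ?_
          intro y hy
          exact mul_le_mul' le_rfl
            (ENNReal.ofReal_le_ofReal (rpow_le_of_notMem_cube hlam0 hlow hy.2))
      _ = (∫⁻ y in T j, h y) * ENNReal.ofReal ((R * 2 ^ (-(j : ℤ) - 1)) ^ (-lam)) :=
          lintegral_mul_const' _ _ ENNReal.ofReal_ne_top
      _ ≤ (∫⁻ y in cube 0 (ρ * 2 ^ ((i : ℤ) - j)), h y) *
            ENNReal.ofReal ((R * 2 ^ (-(j : ℤ) - 1)) ^ (-lam)) := by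
          gcongr
          rw [← e1]
          exact Set.sdiff_subset
      _ ≤ (D * (1 + (((i : ℤ) - j).natAbs : ℝ≥0∞)) *
            volume (cube (0 : EuclideanSpace ℝ (Fin n)) (ρ * 2 ^ ((i : ℤ) - j)))) *
            ENNReal.ofReal ((R * 2 ^ (-(j : ℤ) - 1)) ^ (-lam)) := by
          gcongr
          exact hD _
      _ ≤ (D * (ENNReal.ofReal ((1 + i) * (1 + j))) *
            (ENNReal.ofReal (2 ^ (-(j : ℤ))) ^ n * V)) *
            ENNReal.ofReal ((R * 2 ^ (-(j : ℤ) - 1)) ^ (-lam)) := by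
          gcongr
          · have : (1 + (((i : ℤ) - j).natAbs : ℝ≥0∞)) = ENNReal.ofReal
                (((1 + ((i : ℤ) - j).natAbs : ℕ) : ℝ)) := by
              rw [ENNReal.ofReal_natCast]; push_cast; rfl
            rw [this]
            refine ENNReal.ofReal_le_ofReal ?_
            -- Replacing the logarithmic loss by a product decouples `i` from `j`, so each factor
            -- can be absorbed by its own geometric decay.
            have h1 : 1 + ((i : ℤ) - j).natAbs ≤ (1 + i) * (1 + j) := by
              have : ((i : ℤ) - j).natAbs ≤ i + j := by omega
              nlinarith
            exact_mod_cast h1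
          · rw [← e1]
            exact volume_cube_le_mul hR0 (by positivity) (by rw [mul_comm])
      _ = D * V * ENNReal.ofReal ((1 + i) * (1 + j) *
            ((R * 2 ^ (-(j : ℤ) - 1)) ^ (-lam) * (2 ^ (-(j : ℤ))) ^ n)) := by
          rw [ENNReal.ofReal_mul (p := (1 + (i : ℝ)) * (1 + j)) (by positivity),
            ENNReal.ofReal_mul (p := (R * 2 ^ (-(j : ℤ) - 1)) ^ (-lam)) (by positivity),
            ENNReal.ofReal_pow (by positivity)]
          ring
      _ = D * V * (ENNReal.ofReal (ρ ^ (-lam)) * ENNReal.ofReal ((1 + i) * θ₁ ^ i) *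
            (ENNReal.ofReal (2 ^ lam) * ENNReal.ofReal ((1 + j) * θ₂ ^ j))) := by
          rw [hR, rpow_shell_identity hρ, ← ENNReal.ofReal_mul (by positivity),
            ← ENNReal.ofReal_mul (by positivity), ← ENNReal.ofReal_mul (by positivity)]
          congr 2
          ring
      _ = _ := by ring
  calc ∫⁻ y in cube 0 R, h y * ENNReal.ofReal (‖y‖ ^ (-lam))
      ≤ ∫⁻ y in {0} ∪ ⋃ j, T j, h y * ENNReal.ofReal (‖y‖ ^ (-lam)) :=
        lintegral_mono_set (cube_zero_subset_shells R)
    _ ≤ (∫⁻ y in {0}, h y * ENNReal.ofReal (‖y‖ ^ (-lam))) +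
        ∫⁻ y in ⋃ j, T j, h y * ENNReal.ofReal (‖y‖ ^ (-lam)) := lintegral_union_le _ _ _
    _ = ∫⁻ y in ⋃ j, T j, h y * ENNReal.ofReal (‖y‖ ^ (-lam)) := by
        rw [setLIntegral_measure_zero _ _ (measure_singleton _), zero_add]
    _ ≤ ∑' j, ∫⁻ y in T j, h y * ENNReal.ofReal (‖y‖ ^ (-lam)) := lintegral_iUnion_le _ _
    _ ≤ ∑' j : ℕ, D * ENNReal.ofReal (ρ ^ (-lam)) * ENNReal.ofReal ((1 + i) * θ₁ ^ i) *
        (ENNReal.ofReal (2 ^ lam) * ENNReal.ofReal ((1 + j) * θ₂ ^ j)) * V :=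
        ENNReal.tsum_le_tsum hTj
    _ = D * ENNReal.ofReal (ρ ^ (-lam)) * ENNReal.ofReal ((1 + i) * θ₁ ^ i) *
        (ENNReal.ofReal (2 ^ lam) * S₂) * V := by
        rw [ENNReal.tsum_mul_right, ENNReal.tsum_mul_left, ENNReal.tsum_mul_left]
    -- The factor depending on `i` is a single term of the convergent series `S₁`, hence bounded
    -- uniformly in `i`.
    _ ≤ D * ENNReal.ofReal (ρ ^ (-lam)) * S₁ * (ENNReal.ofReal (2 ^ lam) * S₂) * V := by
        gcongr
        exact ENNReal.le_tsum (f := fun i : ℕ => ENNReal.ofReal ((1 + i) * θ₁ ^ i)) i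
    _ = _ := by ring

/-- The power weight behaves like a constant for averages over all cubes through a point. -/
lemma exists_lintegral_cube_mul_rpow_le {lam : ℝ} (hlam0 : 0 < lam) (hlamn : lam < n) :
    ∃ C : ℝ≥0∞, C ≠ ∞ ∧ ∀ (ρ : ℝ), 0 < ρ → ∀ (x : EuclideanSpace ℝ (Fin n)),
      ρ ≤ ‖x‖ → ‖x‖ < 2 * ρ → ∀ (h : EuclideanSpace ℝ (Fin n) → ℝ≥0∞) (D : ℝ≥0∞),
      (∀ l : ℤ, ∫⁻ y in cube 0 (ρ * 2 ^ l), h y ≤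
        D * (1 + (l.natAbs : ℝ≥0∞)) * volume (cube (0 : EuclideanSpace ℝ (Fin n)) (ρ * 2 ^ l))) →
      (∀ c r, 0 < r → r ≤ ρ → x ∈ cube c r → ∫⁻ y in cube c r, h y ≤ D * volume (cube c r)) →
      ∀ c r, 0 < r → x ∈ cube c r →
        ∫⁻ y in cube c r, h y * ENNReal.ofReal (‖y‖ ^ (-lam)) ≤
          C * D * ENNReal.ofReal (ρ ^ (-lam)) * volume (cube c r) := by
  obtain ⟨C₁, hC₁, H⟩ := exists_lintegral_cube_zero_mul_rpow_le (n := n) hlam0 hlamn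
  have hn : 1 ≤ (n : ℝ) := by
    have : 0 < n := by exact_mod_cast hlam0.trans hlamn
    exact_mod_cast this
  -- The first summand serves small cubes, the second large ones. In the large case `ρ < 4nr`, and
  -- the enclosing centred cube has half-side at most `2(2ρ + 2r) ≤ (16n + 4)r`.
  refine ⟨ENNReal.ofReal (2 ^ lam) + C₁ * ENNReal.ofReal (16 * n + 4) ^ n, ?_, ?_⟩
  · exact ENNReal.add_ne_top.2 ⟨ENNReal.ofReal_ne_top,
      ENNReal.mul_ne_top hC₁ (ENNReal.pow_ne_top ENNReal.ofReal_ne_top)⟩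
  intro ρ hρ x hx1 hx2 h D hD1 hD2 c r hr hxc
  rcases le_or_gt (4 * n * r) ρ with hsmall | hlarge
  · have hrρ : r ≤ ρ := by nlinarith
    have hw : ∀ y ∈ cube c r, ‖y‖ ^ (-lam) ≤ ρ ^ (-lam) * 2 ^ lam := by
      intro y hy
      -- Since `4nr ≤ ρ`, this distance is at most `ρ/2`, so the cube keeps distance at least `ρ/2`
      -- from the origin.
      have h1 : ‖x - y‖ ≤ n * (2 * r) := by
        refine norm_le_mul_of_abs_le _ (by positivity) fun i => ?_
        have h2 := hy i
        have h3 := hxc i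
        rw [abs_lt] at h2 h3
        rw [PiLp.sub_apply, abs_le]
        constructor <;> linarith
      have h2 : ρ / 2 ≤ ‖y‖ := by
        have := norm_sub_norm_le x y
        linarith
      calc ‖y‖ ^ (-lam) ≤ (ρ / 2) ^ (-lam) :=
            Real.rpow_le_rpow_of_nonpos (by positivity) h2 (by linarith)
        _ = ρ ^ (-lam) * 2 ^ lam := by
            rw [Real.div_rpow hρ.le zero_le_two, Real.rpow_neg zero_le_two, div_inv_eq_mul]
    calc ∫⁻ y in cube c r, h y * ENNReal.ofReal (‖y‖ ^ (-lam))
        ≤ ∫⁻ y in cube c r, h y * ENNReal.ofReal (ρ ^ (-lam) * 2 ^ lam) := by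
          refine setLIntegral_mono' (measurableSet_cube _ _) fun y hy => ?_
          gcongr
          exact hw y hy
      _ = (∫⁻ y in cube c r, h y) * ENNReal.ofReal (ρ ^ (-lam) * 2 ^ lam) :=
          lintegral_mul_const' _ _ ENNReal.ofReal_ne_top
      _ ≤ (D * volume (cube c r)) * ENNReal.ofReal (ρ ^ (-lam) * 2 ^ lam) := by
          gcongr
          exact hD2 c r hr hrρ hxc
      _ = ENNReal.ofReal (2 ^ lam) * D * ENNReal.ofReal (ρ ^ (-lam)) * volume (cube c r) := by
          rw [ENNReal.ofReal_mul (by positivity)]; ring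
      _ ≤ _ := by
          gcongr
          exact le_self_add
  · obtain ⟨i, hi1, hi2⟩ := exists_nat_pow_near (x := (2 * ρ + 2 * r) / ρ) (y := 2)
      (by rw [le_div_iff₀ hρ]; linarith) one_lt_two
    rw [le_div_iff₀ hρ] at hi1
    rw [div_lt_iff₀ hρ] at hi2
    have hsub : cube c r ⊆ cube 0 (ρ * 2 ^ ((i + 1 : ℕ) : ℤ)) := by
      refine cube_subset_cube fun k => ?_
      have h1 := hxc k
      have h2 := abs_apply_le_norm x k
      rw [zpow_natCast, PiLp.zero_apply, sub_zero]
      have h3 : |c k| ≤ |x k| + |x k - c k| := by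
        have := abs_sub (x k) (x k - c k)
        rwa [sub_sub_cancel] at this
      nlinarith
    have hvol : volume (cube (0 : EuclideanSpace ℝ (Fin n)) (ρ * 2 ^ ((i + 1 : ℕ) : ℤ))) ≤
        ENNReal.ofReal (16 * n + 4) ^ n * volume (cube c r) := by
      refine volume_cube_le_mul hr (by positivity) ?_
      rw [zpow_natCast, pow_succ]
      nlinarith
    calc ∫⁻ y in cube c r, h y * ENNReal.ofReal (‖y‖ ^ (-lam))
        ≤ ∫⁻ y in cube 0 (ρ * 2 ^ ((i + 1 : ℕ) : ℤ)), h y * ENNReal.ofReal (‖y‖ ^ (-lam)) :=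
          lintegral_mono_set hsub
      _ ≤ _ := H ρ hρ h D hD1 (i + 1)
      _ ≤ C₁ * D * ENNReal.ofReal (ρ ^ (-lam)) *
          (ENNReal.ofReal (16 * n + 4) ^ n * volume (cube c r)) := by gcongr
      _ = C₁ * ENNReal.ofReal (16 * n + 4) ^ n * D * ENNReal.ofReal (ρ ^ (-lam)) *
          volume (cube c r) := by ring
      _ ≤ _ := by
          gcongr
          exact le_add_self

end PowerWeight

/-! ### Morrey norms, dyadic annuli and radially decreasing functions -/

section Morrey

variable {n : ℕ}

/-- The half-open annulus of inner radius `ρ` and outer radius `2 * ρ` about the origin. -/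
def annulus (n : ℕ) (ρ : ℝ) : Set (EuclideanSpace ℝ (Fin n)) := {x | ρ ≤ ‖x‖ ∧ ‖x‖ < 2 * ρ}

lemma measurableSet_annulus (ρ : ℝ) : MeasurableSet (annulus n ρ) :=
  (measurableSet_le measurable_const measurable_norm).inter
    (measurableSet_lt measurable_norm measurable_const)

lemma exists_zpow_mem_annulus {R : ℝ} (hR : 0 < R) {y : EuclideanSpace ℝ (Fin n)} (hy : y ≠ 0) :
    ∃ k : ℤ, y ∈ annulus n (R * 2 ^ k) := by
  obtain ⟨k, hk1, hk2⟩ := exists_mem_Ico_zpow (div_pos (norm_pos_iff.2 hy) hR) one_lt_two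
  refine ⟨k, ?_, ?_⟩
  · rw [le_div_iff₀ hR] at hk1; linarith
  · rw [div_lt_iff₀ hR, zpow_add_one₀ two_ne_zero] at hk2; linarith

/-- Annuli of scale below `R` are taken whole, as their contributions sum. On those of scale at
least `R` the restriction to the ball is kept, because its volume is needed there. -/
lemma ball_subset_annuli {R : ℝ} (hR : 0 < R) (x : EuclideanSpace ℝ (Fin n)) :
    Metric.ball x R ⊆ ({0} ∪ ⋃ j : ℕ, annulus n (R * 2 ^ (-(j : ℤ) - 1))) ∪
      (Metric.ball x R ∩ ⋃ j : ℕ, annulus n (R * 2 ^ (j : ℤ))) := by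
  intro y hy
  by_cases h0 : y = 0
  · exact Or.inl (Or.inl h0)
  obtain ⟨k, hk⟩ := exists_zpow_mem_annulus hR h0
  rcases le_or_gt 0 k with h | h
  · refine Or.inr ⟨hy, Set.mem_iUnion.2 ⟨k.toNat, ?_⟩⟩
    rwa [Int.toNat_of_nonneg h]
  · refine Or.inl (Or.inr (Set.mem_iUnion.2 ⟨(-k - 1).toNat, ?_⟩))
    rw [Int.toNat_of_nonneg (by omega)]
    have e : -(-k - 1) - 1 = k := by ring
    rwa [e]

/-- Either `g ≤ s`, or `(g/s)^q ≥ 1`. The level `s` will be `ρ^(-λ)` or `R^(-λ)`, the natural size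
of the function at that scale. -/
lemma ENNReal.le_add_inv_pow_mul_pow {s : ℝ} (hs : 0 < s) (q : ℕ) (g : ℝ≥0∞) :
    g ≤ ENNReal.ofReal s + ENNReal.ofReal s⁻¹ ^ q * g ^ (q + 1) := by
  rcases le_or_gt g (ENNReal.ofReal s) with h | h
  · exact h.trans le_self_add
  · refine le_add_left ?_
    have h1 : ENNReal.ofReal s⁻¹ * ENNReal.ofReal s = 1 := by
      rw [← ENNReal.ofReal_mul (by positivity), inv_mul_cancel₀ hs.ne', ENNReal.ofReal_one]
    calc g = (ENNReal.ofReal s⁻¹ * ENNReal.ofReal s) ^ q * g := by rw [h1, one_pow, one_mul]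
      _ ≤ (ENNReal.ofReal s⁻¹ * g) ^ q * g := by gcongr
      _ = _ := by rw [mul_pow, pow_succ, mul_assoc]

lemma setLIntegral_le_add_pow {α : Type*} [MeasurableSpace α] {μ : Measure α} (F : Set α)
    (g : α → ℝ≥0∞) {s : ℝ} (hs : 0 < s) (q : ℕ) :
    ∫⁻ y in F, g y ∂μ ≤
      ENNReal.ofReal s * μ F + ENNReal.ofReal s⁻¹ ^ q * ∫⁻ y in F, g y ^ (q + 1) ∂μ := by
  calc ∫⁻ y in F, g y ∂μ
      ≤ ∫⁻ y in F, (ENNReal.ofReal s + ENNReal.ofReal s⁻¹ ^ q * g y ^ (q + 1)) ∂μ :=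
        lintegral_mono fun y => ENNReal.le_add_inv_pow_mul_pow hs q (g y)
    _ = _ := by
        rw [lintegral_add_left measurable_const, setLIntegral_const,
          lintegral_const_mul' _ _ (ENNReal.pow_ne_top ENNReal.ofReal_ne_top)]

lemma volume_ball_eq [Nontrivial (EuclideanSpace ℝ (Fin n))] (x : EuclideanSpace ℝ (Fin n))
    {r : ℝ} (hr : 0 ≤ r) : volume (Metric.ball x r) =
      ENNReal.ofReal (r ^ n) * volume (Metric.ball (0 : EuclideanSpace ℝ (Fin n)) 1) := by
  rw [Measure.addHaar_ball volume x hr, finrank_euclideanSpace_fin]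

lemma tsum_ofReal_pow_ne_top {θ : ℝ} (h1 : θ < 1) :
    ∑' j : ℕ, ENNReal.ofReal θ ^ j ≠ ∞ := by
  rw [ENNReal.tsum_geometric]
  exact ENNReal.inv_ne_top.2 (tsub_pos_of_lt (by rwa [ENNReal.ofReal_lt_one])).ne'

/-- A scale invariant bound for a high moment over dyadic annuli bounds the Morrey norm. -/
theorem exists_morreyNorm_le_of_annulus {lam : ℝ} (hlam0 : 0 < lam) (hlamn : lam < n) {q : ℕ}
    (hq : n < lam * (q + 1)) {D : ℝ≥0∞} (hD : D ≠ ∞) :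
    ∃ C : ℝ≥0∞, C ≠ ∞ ∧ ∀ g : EuclideanSpace ℝ (Fin n) → ℝ≥0∞,
      (∀ ρ : ℝ, 0 < ρ → ∫⁻ y in annulus n ρ, g y ^ (q + 1) ≤
        D * ENNReal.ofReal (ρ ^ (n - lam * (q + 1)))) → morreyNorm lam g ≤ C := by
  have := nontrivial_of_pos_lt hlam0 hlamn
  set V := volume (Metric.ball (0 : EuclideanSpace ℝ (Fin n)) 1) with hV
  have hVT : V ≠ ∞ := measure_ball_lt_top.ne
  set θ₁ : ℝ := 2 ^ (lam - n) with hθ₁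
  set θ₂ : ℝ := 2 ^ (n - lam * (q + 1)) with hθ₂
  have h11 : θ₁ < 1 := Real.rpow_lt_one_of_one_lt_of_neg one_lt_two (by linarith)
  have h21 : θ₂ < 1 := Real.rpow_lt_one_of_one_lt_of_neg one_lt_two (by linarith)
  set S₁ := ∑' j : ℕ, ENNReal.ofReal θ₁ ^ j with hS₁
  set S₂ := ∑' j : ℕ, ENNReal.ofReal θ₂ ^ j with hS₂
  have hS₁T : S₁ ≠ ∞ := tsum_ofReal_pow_ne_top h11
  have hS₂T : S₂ ≠ ∞ := tsum_ofReal_pow_ne_top h21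
  refine ⟨(2 ^ n * V + D) * (ENNReal.ofReal θ₁ * S₁) + (V + D * S₂), ?_, ?_⟩
  · finiteness
  intro g hg
  have hinner : ∀ ρ : ℝ, 0 < ρ →
      ∫⁻ y in annulus n ρ, g y ≤ (2 ^ n * V + D) * ENNReal.ofReal (ρ ^ (n - lam)) := by
    intro ρ hρ
    have hvol : volume (annulus n ρ) ≤ ENNReal.ofReal (2 ^ n * ρ ^ (n : ℝ)) * V := by
      rw [Real.rpow_natCast, ← mul_pow, ← volume_ball_eq 0 (by positivity)]
      refine measure_mono fun y hy => ?_
      rw [mem_ball_zero_iff]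
      exact hy.2
    calc ∫⁻ y in annulus n ρ, g y
        ≤ ENNReal.ofReal (ρ ^ (-lam)) * volume (annulus n ρ) +
          ENNReal.ofReal (ρ ^ (-lam))⁻¹ ^ q * ∫⁻ y in annulus n ρ, g y ^ (q + 1) :=
          setLIntegral_le_add_pow _ g (by positivity) q
      _ ≤ ENNReal.ofReal (ρ ^ (-lam)) * (ENNReal.ofReal (2 ^ n * ρ ^ (n : ℝ)) * V) +
          ENNReal.ofReal (ρ ^ (-lam))⁻¹ ^ q *
            (D * ENNReal.ofReal (ρ ^ (n - lam * (q + 1)))) := by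
          gcongr
          exact hg ρ hρ
      _ = ENNReal.ofReal (2 ^ n * (ρ ^ (-lam) * ρ ^ (n : ℝ))) * V +
          D * ENNReal.ofReal (((ρ ^ (-lam))⁻¹) ^ q * ρ ^ (n - lam * (q + 1))) := by
          rw [← mul_assoc, ← ENNReal.ofReal_mul (by positivity),
            ENNReal.ofReal_mul (p := ((ρ ^ (-lam))⁻¹) ^ q) (by positivity),
            ENNReal.ofReal_pow (by positivity)]
          ring_nf
      _ = _ := by
          have e1 : ρ ^ (-lam) * ρ ^ (n : ℝ) = ρ ^ (n - lam) := by
            rw [← Real.rpow_add hρ]; ring_nf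
          have e2 : ((ρ ^ (-lam))⁻¹) ^ q * ρ ^ (n - lam * (q + 1)) = ρ ^ (n - lam) := by
            rw [← Real.rpow_neg hρ.le, neg_neg, ← Real.rpow_natCast, ← Real.rpow_mul hρ.le,
              ← Real.rpow_add hρ]
            ring_nf
          rw [e1, e2, ENNReal.ofReal_mul (by positivity), ENNReal.ofReal_pow zero_le_two,
            ENNReal.ofReal_ofNat]
          ring
  refine iSup_le fun x => iSup_le fun R => iSup_le fun hR => ?_
  simp only [enorm_eq_self]
  have hin : ∫⁻ y in {0} ∪ ⋃ j : ℕ, annulus n (R * 2 ^ (-(j : ℤ) - 1)), g y ≤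
      (2 ^ n * V + D) * (ENNReal.ofReal θ₁ * S₁) * ENNReal.ofReal (R ^ (n - lam)) := by
    calc _ ≤ (∫⁻ y in {0}, g y) + ∫⁻ y in ⋃ j : ℕ, annulus n (R * 2 ^ (-(j : ℤ) - 1)), g y :=
          lintegral_union_le _ _ _
      _ = ∫⁻ y in ⋃ j : ℕ, annulus n (R * 2 ^ (-(j : ℤ) - 1)), g y := by
          rw [setLIntegral_measure_zero _ _ (measure_singleton _), zero_add]
      _ ≤ ∑' j : ℕ, ∫⁻ y in annulus n (R * 2 ^ (-(j : ℤ) - 1)), g y := lintegral_iUnion_le _ _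
      _ ≤ ∑' j : ℕ, (2 ^ n * V + D) * ENNReal.ofReal (R ^ (n - lam)) * ENNReal.ofReal θ₁ *
            ENNReal.ofReal θ₁ ^ j := by
          refine ENNReal.tsum_le_tsum fun j => (hinner _ (by positivity)).trans_eq ?_
          have e : (R * 2 ^ (-(j : ℤ) - 1)) ^ (n - lam) = R ^ (n - lam) * (θ₁ * θ₁ ^ j) := by
            rw [Real.mul_rpow hR.le (by positivity), ← pow_succ', hθ₁, ← Real.rpow_intCast,
              ← Real.rpow_natCast, ← Real.rpow_mul zero_le_two, ← Real.rpow_mul zero_le_two]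
            congr 2
            push_cast
            ring
          rw [e, ENNReal.ofReal_mul (by positivity), ENNReal.ofReal_mul (by positivity),
            ENNReal.ofReal_pow (by positivity)]
          ring
      _ = _ := by rw [ENNReal.tsum_mul_left]; ring
  have hout : ∫⁻ y in Metric.ball x R ∩ ⋃ j : ℕ, annulus n (R * 2 ^ (j : ℤ)), g y ≤
      (V + D * S₂) * ENNReal.ofReal (R ^ (n - lam)) := by
    -- Truncation at height `R^(-λ)`: the part below it costs `R^(-λ)` times the volume of the ball,
    -- and the part above is summed over the annuli by the decaying high moments.
    set F := Metric.ball x R ∩ ⋃ j : ℕ, annulus n (R * 2 ^ (j : ℤ))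
    have hF : volume F ≤ ENNReal.ofReal (R ^ (n : ℝ)) * V := by
      rw [Real.rpow_natCast, ← volume_ball_eq x hR.le]
      exact measure_mono Set.inter_subset_left
    have hFg : ∫⁻ y in F, g y ^ (q + 1) ≤
        D * S₂ * ENNReal.ofReal (R ^ (n - lam * (q + 1))) := by
      calc _ ≤ ∫⁻ y in ⋃ j : ℕ, annulus n (R * 2 ^ (j : ℤ)), g y ^ (q + 1) :=
            lintegral_mono_set Set.inter_subset_right
        _ ≤ ∑' j : ℕ, ∫⁻ y in annulus n (R * 2 ^ (j : ℤ)), g y ^ (q + 1) :=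
            lintegral_iUnion_le _ _
        _ ≤ ∑' j : ℕ, D * ENNReal.ofReal (R ^ (n - lam * (q + 1))) * ENNReal.ofReal θ₂ ^ j := by
            refine ENNReal.tsum_le_tsum fun j => (hg _ (by positivity)).trans_eq ?_
            have e : (R * 2 ^ (j : ℤ)) ^ (n - lam * (q + 1)) =
                R ^ (n - lam * (q + 1)) * θ₂ ^ j := by
              rw [Real.mul_rpow hR.le (by positivity), hθ₂, ← Real.rpow_intCast,
                ← Real.rpow_natCast, ← Real.rpow_mul zero_le_two, ← Real.rpow_mul zero_le_two]
              congr 2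
              push_cast
              ring
            rw [e, ENNReal.ofReal_mul (by positivity), ENNReal.ofReal_pow (by positivity)]
            ring
        _ = _ := by rw [ENNReal.tsum_mul_left]; ring
    calc ∫⁻ y in F, g y
        ≤ ENNReal.ofReal (R ^ (-lam)) * volume F +
          ENNReal.ofReal (R ^ (-lam))⁻¹ ^ q * ∫⁻ y in F, g y ^ (q + 1) :=
          setLIntegral_le_add_pow _ g (by positivity) q
      _ ≤ ENNReal.ofReal (R ^ (-lam)) * (ENNReal.ofReal (R ^ (n : ℝ)) * V) +
          ENNReal.ofReal (R ^ (-lam))⁻¹ ^ q *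
            (D * S₂ * ENNReal.ofReal (R ^ (n - lam * (q + 1)))) := by
          gcongr
      _ = ENNReal.ofReal (R ^ (-lam) * R ^ (n : ℝ)) * V +
          D * S₂ * ENNReal.ofReal (((R ^ (-lam))⁻¹) ^ q * R ^ (n - lam * (q + 1))) := by
          rw [← mul_assoc, ← ENNReal.ofReal_mul (by positivity),
            ENNReal.ofReal_mul (p := ((R ^ (-lam))⁻¹) ^ q) (by positivity),
            ENNReal.ofReal_pow (by positivity)]
          ring_nf
      _ = _ := by
          have e1 : R ^ (-lam) * R ^ (n : ℝ) = R ^ (n - lam) := by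
            rw [← Real.rpow_add hR]; ring_nf
          have e2 : ((R ^ (-lam))⁻¹) ^ q * R ^ (n - lam * (q + 1)) = R ^ (n - lam) := by
            rw [← Real.rpow_neg hR.le, neg_neg, ← Real.rpow_natCast, ← Real.rpow_mul hR.le,
              ← Real.rpow_add hR]
            ring_nf
          rw [e1, e2]
          ring
  have e3 : ENNReal.ofReal (R ^ (lam - n)) * ENNReal.ofReal (R ^ (n - lam)) = 1 := by
    rw [← ENNReal.ofReal_mul (by positivity), ← Real.rpow_add hR, sub_add_sub_cancel, sub_self,
      Real.rpow_zero, ENNReal.ofReal_one]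
  calc ENNReal.ofReal (R ^ (lam - n)) * ∫⁻ y in Metric.ball x R, g y
      ≤ ENNReal.ofReal (R ^ (lam - n)) *
        ((2 ^ n * V + D) * (ENNReal.ofReal θ₁ * S₁) * ENNReal.ofReal (R ^ (n - lam)) +
          (V + D * S₂) * ENNReal.ofReal (R ^ (n - lam))) := by
        gcongr
        exact ((lintegral_mono_set (ball_subset_annuli hR x)).trans
          (lintegral_union_le _ _ _)).trans (add_le_add hin hout)
    _ = (ENNReal.ofReal (R ^ (lam - n)) * ENNReal.ofReal (R ^ (n - lam))) *
        ((2 ^ n * V + D) * (ENNReal.ofReal θ₁ * S₁) + (V + D * S₂)) := by ring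
    _ = _ := by rw [e3, one_mul]

lemma lintegral_ball_le_of_morreyNorm {ε : Type*} [ENorm ε] (lam : ℝ)
    (f : EuclideanSpace ℝ (Fin n) → ε) (x : EuclideanSpace ℝ (Fin n)) {r : ℝ} (hr : 0 < r) :
    ENNReal.ofReal (r ^ (lam - n)) * ∫⁻ y in Metric.ball x r, ‖f y‖ₑ ≤ morreyNorm lam f :=
  le_iSup_of_le x (le_iSup_of_le r (le_iSup_of_le hr le_rfl))

/-- A lower bound for a function on a ball is controlled by its Morrey norm. -/
lemma le_morreyNorm_of_forall_le [Nontrivial (EuclideanSpace ℝ (Fin n))] (lam : ℝ)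
    (f : EuclideanSpace ℝ (Fin n) → ℝ) (x : EuclideanSpace ℝ (Fin n)) {r : ℝ} (hr : 0 < r)
    {m : ℝ≥0∞} (hm : ∀ y ∈ Metric.ball x r, y ≠ 0 → m ≤ ‖f y‖ₑ) :
    m * ENNReal.ofReal (r ^ lam) * volume (Metric.ball (0 : EuclideanSpace ℝ (Fin n)) 1) ≤
      morreyNorm lam f := by
  refine le_trans ?_ (lintegral_ball_le_of_morreyNorm lam f x hr)
  have h1 : m * volume (Metric.ball x r) ≤ ∫⁻ y in Metric.ball x r, ‖f y‖ₑ := by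
    rw [← setLIntegral_const]
    refine lintegral_mono_ae ?_
    have h0 : ∀ᵐ y : EuclideanSpace ℝ (Fin n), y ≠ 0 :=
      compl_mem_ae_iff.2 (measure_singleton _)
    filter_upwards [ae_restrict_mem measurableSet_ball, ae_restrict_of_ae h0] with y hy hy0
    exact hm y hy hy0
  calc _ = ENNReal.ofReal (r ^ (lam - n)) * (m * volume (Metric.ball x r)) := by
        have e : r ^ lam = r ^ (lam - n) * r ^ n := by
          rw [← Real.rpow_natCast, ← Real.rpow_add hr, sub_add_cancel]
        rw [volume_ball_eq x hr.le, e, ENNReal.ofReal_mul (by positivity)]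
        ring
    _ ≤ _ := by gcongr

/-- A negative value `φ t` would force `|f| ≥ |φ t|` outside the ball of radius `t`. Balls of radius
`r` far from the origin then give a lower bound for the Morrey norm of order `r^λ`, which tends to
infinity. -/
lemma RadiallyDecreasing.nonneg {lam : ℝ} (hlam0 : 0 < lam)
    [Nontrivial (EuclideanSpace ℝ (Fin n))] {f : EuclideanSpace ℝ (Fin n) → ℝ} {φ : ℝ → ℝ}
    (hφ : AntitoneOn φ (Set.Ioi 0)) (hf : ∀ x, x ≠ 0 → f x = φ ‖x‖) (hM : morreyNorm lam f < ∞)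
    {t : ℝ} (ht : 0 < t) : 0 ≤ φ t := by
  by_contra hneg
  push Not at hneg
  set V := volume (Metric.ball (0 : EuclideanSpace ℝ (Fin n)) 1)
  have hV0 : V ≠ 0 := (Metric.measure_ball_pos _ _ one_pos).ne'
  have key : ∀ r : ℝ, t < r → ‖φ t‖ₑ * ENNReal.ofReal (r ^ lam) * V ≤ morreyNorm lam f := by
    intro r hr
    have hr0 : 0 < r := ht.trans hr
    -- A centre of norm above `2r` keeps the ball of radius `r` outside the ball of radius `r > t`
    -- about the origin.
    obtain ⟨x, hx⟩ := NormedSpace.exists_lt_norm ℝ (EuclideanSpace ℝ (Fin n)) (2 * r)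
    refine le_morreyNorm_of_forall_le lam f x hr0 fun y hy hy0 => ?_
    have h1 : t < ‖y‖ := by
      have h2 := norm_sub_norm_le x y
      rw [mem_ball_iff_norm'] at hy
      linarith
    have h3 := hφ (Set.mem_Ioi.2 ht) (Set.mem_Ioi.2 (ht.trans h1)) h1.le
    rw [hf y hy0, ← ofReal_norm, ← ofReal_norm, Real.norm_of_nonpos hneg.le,
      Real.norm_of_nonpos (h3.trans hneg.le)]
    exact ENNReal.ofReal_le_ofReal (by linarith)
  have hlim : Filter.Tendsto (fun r : ℝ => ‖φ t‖ₑ * ENNReal.ofReal (r ^ lam) * V)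
      Filter.atTop (nhds ∞) := by
    have h1 : Filter.Tendsto (fun r : ℝ => ENNReal.ofReal (r ^ lam)) Filter.atTop (nhds ∞) :=
      ENNReal.tendsto_ofReal_atTop.comp (tendsto_rpow_atTop hlam0)
    have h2 := ENNReal.Tendsto.const_mul (a := ‖φ t‖ₑ) h1 (Or.inl ENNReal.top_ne_zero)
    rw [ENNReal.mul_top (by simpa using hneg.ne)] at h2
    have h3 := ENNReal.Tendsto.mul_const (b := V) h2 (Or.inl ENNReal.top_ne_zero)
    rwa [ENNReal.top_mul hV0] at h3
  have := le_of_tendsto hlim (Filter.eventually_atTop.2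
    ⟨t + 1, fun r hr => key r (by linarith)⟩)
  exact absurd hM (not_lt.2 this)

/-- Radially decreasing Morrey functions are dominated by the critical power. -/
theorem RadiallyDecreasing.enorm_le {lam : ℝ} (hlam0 : 0 < lam)
    [Nontrivial (EuclideanSpace ℝ (Fin n))] {f : EuclideanSpace ℝ (Fin n) → ℝ}
    (hf : RadiallyDecreasing f) (hM : morreyNorm lam f < ∞) {x : EuclideanSpace ℝ (Fin n)}
    (hx : x ≠ 0) :
    ‖f x‖ₑ ≤ (volume (Metric.ball (0 : EuclideanSpace ℝ (Fin n)) 1))⁻¹ * morreyNorm lam f *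
      ENNReal.ofReal (‖x‖ ^ (-lam)) := by
  obtain ⟨φ, hφ, hfφ⟩ := hf
  set V := volume (Metric.ball (0 : EuclideanSpace ℝ (Fin n)) 1)
  have hV0 : V ≠ 0 := (Metric.measure_ball_pos _ _ one_pos).ne'
  have hVT : V ≠ ∞ := measure_ball_lt_top.ne
  have hx0 : 0 < ‖x‖ := norm_pos_iff.2 hx
  have h := le_morreyNorm_of_forall_le lam f 0 hx0 (m := ‖f x‖ₑ) fun y hy hy0 => by
    rw [mem_ball_zero_iff] at hy
    have h1 := hφ (Set.mem_Ioi.2 (norm_pos_iff.2 hy0)) (Set.mem_Ioi.2 hx0) hy.le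
    have h2 := RadiallyDecreasing.nonneg hlam0 hφ hfφ hM hx0
    rw [hfφ x hx, hfφ y hy0, ← ofReal_norm, ← ofReal_norm, Real.norm_of_nonneg h2,
      Real.norm_of_nonneg (h2.trans h1)]
    exact ENNReal.ofReal_le_ofReal h1
  have e1 : ENNReal.ofReal (‖x‖ ^ lam) * ENNReal.ofReal (‖x‖ ^ (-lam)) = 1 := by
    rw [← ENNReal.ofReal_mul (by positivity), ← Real.rpow_add hx0, add_neg_cancel,
      Real.rpow_zero, ENNReal.ofReal_one]
  calc ‖f x‖ₑ = (V⁻¹ * V) * ‖f x‖ₑ *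
        (ENNReal.ofReal (‖x‖ ^ lam) * ENNReal.ofReal (‖x‖ ^ (-lam))) := by
        rw [e1, ENNReal.inv_mul_cancel hV0 hVT, one_mul, mul_one]
    _ = V⁻¹ * (‖f x‖ₑ * ENNReal.ofReal (‖x‖ ^ lam) * V) * ENNReal.ofReal (‖x‖ ^ (-lam)) := by
        ring
    _ ≤ _ := by gcongr

end Morrey

/-! ### Dyadic means of a BMO function at a given scale -/

section DyadicGrid

variable {n : ℕ}

/-- Side length of the cells of level `m` of the dyadic grid at scale `ρ`. -/
noncomputable def gridSide (ρ : ℝ) (m : ℕ) : ℝ := 4 * ρ / 2 ^ m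

/-- Label of the cell of level `m` that contains `x`, in the dyadic grid whose cell of level `0` and
label `0` is the half-open cube `[-2ρ, 2ρ)ⁿ`. -/
noncomputable def gridLabel (ρ : ℝ) (m : ℕ) (x : EuclideanSpace ℝ (Fin n)) : Fin n → ℤ :=
  fun i => ⌊(x i + 2 * ρ) / gridSide ρ m⌋

/-- Lower corner of a cell of the dyadic grid. -/
noncomputable def gridCorner (ρ : ℝ) (m : ℕ) (l : Fin n → ℤ) : EuclideanSpace ℝ (Fin n) :=
  WithLp.toLp 2 fun i => gridSide ρ m * l i - 2 * ρ

/-- Mean of `b` over the open cube about the lower corner of a cell which contains the cell. -/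
noncomputable def gridMean (b : EuclideanSpace ℝ (Fin n) → ℝ) (ρ : ℝ) (m : ℕ) (l : Fin n → ℤ) : ℝ :=
  cubeMean b (gridCorner ρ m l) (gridSide ρ m)

lemma gridSide_pos {ρ : ℝ} (hρ : 0 < ρ) (m : ℕ) : 0 < gridSide ρ m := by
  unfold gridSide; positivity

lemma gridSide_eq_two_mul_succ (ρ : ℝ) (m : ℕ) : gridSide ρ m = 2 * gridSide ρ (m + 1) := by
  unfold gridSide; rw [pow_succ]; field_simp

lemma gridLabel_eq_iff {ρ : ℝ} (hρ : 0 < ρ) {m : ℕ} {x : EuclideanSpace ℝ (Fin n)}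
    {l : Fin n → ℤ} : gridLabel ρ m x = l ↔
      ∀ i, gridCorner ρ m l i ≤ x i ∧ x i < gridCorner ρ m l i + gridSide ρ m := by
  have hs := gridSide_pos hρ m
  rw [funext_iff]
  refine forall_congr' fun i => ?_
  simp only [gridLabel, gridCorner]
  rw [Int.floor_eq_iff, le_div_iff₀ hs, div_lt_iff₀ hs]
  constructor <;> rintro ⟨h1, h2⟩ <;> constructor <;> linarith

lemma measurableSet_gridLabel_preimage (ρ : ℝ) (m : ℕ) (l : Fin n → ℤ) :
    MeasurableSet (gridLabel ρ m ⁻¹' {l} : Set (EuclideanSpace ℝ (Fin n))) := by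
  have : Measurable (gridLabel ρ m : EuclideanSpace ℝ (Fin n) → Fin n → ℤ) := by
    refine measurable_pi_lambda _ fun i => Int.measurable_floor.comp ?_
    fun_prop
  exact this (measurableSet_singleton l)

lemma gridLabel_nested {ρ : ℝ} (m : ℕ) (x y : EuclideanSpace ℝ (Fin n))
    (h : gridLabel ρ (m + 1) x = gridLabel ρ (m + 1) y) : gridLabel ρ m x = gridLabel ρ m y := by
  have key : ∀ u v : ℝ, ⌊2 * u⌋ = ⌊2 * v⌋ → ⌊u⌋ ≤ ⌊v⌋ := by
    intro u v huv
    have h1 : 2 * ⌊u⌋ ≤ ⌊2 * u⌋ := by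
      rw [Int.le_floor]; push_cast; linarith [Int.floor_le u]
    rw [huv, Int.le_floor] at h1
    push_cast at h1
    rw [Int.le_floor]
    linarith
  have hx : ∀ (z : EuclideanSpace ℝ (Fin n)) (i : Fin n),
      (z i + 2 * ρ) / gridSide ρ (m + 1) = 2 * ((z i + 2 * ρ) / gridSide ρ m) := by
    intro z i
    rw [gridSide_eq_two_mul_succ ρ m, ← mul_div_assoc, mul_div_mul_left _ _ two_ne_zero]
  ext i
  have hi := congrFun h i
  simp only [gridLabel, hx] at hi ⊢
  exact le_antisymm (key _ _ hi) (key _ _ hi.symm)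

lemma gridLabel_preimage_subset_cube {ρ : ℝ} (hρ : 0 < ρ) (m : ℕ) (l : Fin n → ℤ) :
    gridLabel ρ m ⁻¹' {l} ⊆ cube (gridCorner ρ m l) (gridSide ρ m) := by
  intro x hx i
  have := (gridLabel_eq_iff hρ).1 hx i
  rw [abs_lt]
  constructor <;> linarith [gridSide_pos hρ m]

/-- The concentric open cube of half-side `gridSide ρ m / 2` lies in the cell, and doubling its side
gives the volume of the cube on the left. -/
lemma volume_cube_gridCorner_le {ρ : ℝ} (hρ : 0 < ρ) (m : ℕ) (l : Fin n → ℤ) :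
    volume (cube (gridCorner ρ m l) (gridSide ρ m)) ≤
      2 ^ n * volume (gridLabel ρ m ⁻¹' {l} : Set (EuclideanSpace ℝ (Fin n))) := by
  have hs := gridSide_pos hρ m
  set c : EuclideanSpace ℝ (Fin n) := WithLp.toLp 2 fun i => gridCorner ρ m l i + gridSide ρ m / 2
  have hsub : cube c (gridSide ρ m / 2) ⊆ gridLabel ρ m ⁻¹' {l} := by
    intro x hx
    refine (gridLabel_eq_iff hρ).2 fun i => ?_
    have := hx i
    simp only [c, abs_lt] at this
    constructor <;> linarith
  calc _ ≤ ENNReal.ofReal 2 ^ n * volume (cube c (gridSide ρ m / 2)) :=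
        volume_cube_le_mul (by positivity) hs (by linarith)
    _ ≤ _ := by
      rw [ENNReal.ofReal_ofNat]
      gcongr

lemma volume_gridLabel_preimage_ne_top {ρ : ℝ} (hρ : 0 < ρ) (m : ℕ) (l : Fin n → ℤ) :
    volume (gridLabel ρ m ⁻¹' {l} : Set (EuclideanSpace ℝ (Fin n))) ≠ ∞ :=
  measure_ne_top_of_subset (gridLabel_preimage_subset_cube hρ m l)
    (volume_cube_ne_top _ (gridSide_pos hρ m))

lemma volume_gridLabel_preimage_ne_zero {ρ : ℝ} (hρ : 0 < ρ) (m : ℕ) (l : Fin n → ℤ) :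
    volume (gridLabel ρ m ⁻¹' {l} : Set (EuclideanSpace ℝ (Fin n))) ≠ 0 := by
  intro h
  have := volume_cube_gridCorner_le hρ m l
  rw [h, mul_zero, nonpos_iff_eq_zero] at this
  exact volume_cube_ne_zero _ (gridSide_pos hρ m) this

lemma annulus_subset_gridLabel_preimage {ρ : ℝ} (hρ : 0 < ρ) :
    annulus n ρ ⊆ gridLabel ρ 0 ⁻¹' {0} := by
  intro x hx
  refine (gridLabel_eq_iff hρ).2 fun i => ?_
  have h1 := (abs_apply_le_norm x i).trans_lt hx.2
  rw [abs_lt] at h1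
  simp only [gridCorner, gridSide, Pi.zero_apply, Int.cast_zero]
  constructor <;> linarith

lemma lintegral_sub_gridMean_le (b : EuclideanSpace ℝ (Fin n) → ℝ) {ρ : ℝ} (hρ : 0 < ρ) (m : ℕ)
    (l : Fin n → ℤ) : ∫⁻ y in gridLabel ρ m ⁻¹' {l}, ‖b y - gridMean b ρ m l‖ₑ ≤
      2 ^ n * bmoSeminorm b *
        volume (gridLabel ρ m ⁻¹' {l} : Set (EuclideanSpace ℝ (Fin n))) :=
  lintegral_sub_cubeMean_le_of_subset b (gridSide_pos hρ m)
    (gridLabel_preimage_subset_cube hρ m l) (volume_cube_gridCorner_le hρ m l)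

/-- Both means are compared with `b` on the child cell, which fills at least a `4^(-n)` share of the
cube that defines the parent's mean. -/
lemma enorm_gridMean_succ_sub_le {b : EuclideanSpace ℝ (Fin n) → ℝ} (hb : AEMeasurable b volume)
    {ρ : ℝ} (hρ : 0 < ρ) (m : ℕ) (x : EuclideanSpace ℝ (Fin n)) :
    ‖gridMean b ρ (m + 1) (gridLabel ρ (m + 1) x) - gridMean b ρ m (gridLabel ρ m x)‖ₑ ≤
      (2 ^ n + 2 ^ n * 2 ^ n) * bmoSeminorm b := by
  rw [add_mul]
  refine enorm_sub_le_of_lintegral_le hb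
    (volume_gridLabel_preimage_ne_zero hρ (m + 1) (gridLabel ρ (m + 1) x))
    (volume_gridLabel_preimage_ne_top hρ _ _) (lintegral_sub_gridMean_le b hρ _ _) ?_
  refine lintegral_sub_cubeMean_le_of_subset b (gridSide_pos hρ m) ?_ ?_
  · refine subset_trans ?_ (gridLabel_preimage_subset_cube hρ m _)
    exact fun y hy => gridLabel_nested m y x hy
  · calc _ ≤ ENNReal.ofReal 2 ^ n * volume (cube (gridCorner ρ (m + 1) (gridLabel ρ (m + 1) x))
          (gridSide ρ (m + 1))) :=
          volume_cube_le_mul (gridSide_pos hρ _) (gridSide_pos hρ _)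
            (gridSide_eq_two_mul_succ ρ m).le
      _ ≤ _ := by
          rw [ENNReal.ofReal_ofNat, mul_assoc]
          gcongr
          exact volume_cube_gridCorner_le hρ _ _

/-- The maximal deviation at `x` of the means over dyadic cells from the mean at level `0`. -/
noncomputable def gridDeviation (b : EuclideanSpace ℝ (Fin n) → ℝ) (ρ : ℝ)
    (x : EuclideanSpace ℝ (Fin n)) : ℝ≥0∞ :=
  ⨆ k, ‖gridMean b ρ k (gridLabel ρ k x) - gridMean b ρ 0 0‖ₑ

lemma lintegral_annulus_gridDeviation_pow_le {b : EuclideanSpace ℝ (Fin n) → ℝ}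
    (hb : AEMeasurable b volume) {δ : ℝ≥0∞} (hδ0 : δ ≠ 0) (hδT : δ ≠ ∞)
    (hδ : (2 ^ n + 2 ^ n * 2 ^ n) * bmoSeminorm b ≤ δ) {ρ : ℝ} (hρ : 0 < ρ) (p : ℕ) :
    ∫⁻ y in annulus n ρ, (δ + gridDeviation b ρ y) ^ p ≤
      (∑' j : ℕ, (4 * δ * (j + 2)) ^ p * 2⁻¹ ^ j) * ENNReal.ofReal (8 * ρ) ^ n := by
  have hvol : volume (gridLabel ρ 0 ⁻¹' {0} : Set (EuclideanSpace ℝ (Fin n))) ≤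
      ENNReal.ofReal (8 * ρ) ^ n := by
    refine (measure_mono (gridLabel_preimage_subset_cube hρ 0 0)).trans_eq ?_
    rw [volume_cube _ (gridSide_pos hρ 0), gridSide]
    congr 2
    ring
  calc _ ≤ ∫⁻ y in gridLabel ρ 0 ⁻¹' {0}, (δ + gridDeviation b ρ y) ^ p :=
        lintegral_mono_set (annulus_subset_gridLabel_preimage hρ)
    _ ≤ (∑' j : ℕ, (4 * δ * (j + 2)) ^ p * 2⁻¹ ^ j) *
          volume (gridLabel ρ 0 ⁻¹' {0} : Set (EuclideanSpace ℝ (Fin n))) := by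
        refine lintegral_iSup_deviation_pow_le (measurableSet_gridLabel_preimage ρ)
          gridLabel_nested (volume_gridLabel_preimage_ne_top hρ) hb hδ0 hδT ?_ ?_ p 0
        · exact fun m x => (enorm_gridMean_succ_sub_le hb hρ m x).trans hδ
        · intro m l
          refine (lintegral_sub_gridMean_le b hρ m l).trans ?_
          gcongr
          refine le_trans ?_ hδ
          gcongr
          exact le_self_add
    _ ≤ _ := by gcongr

lemma lintegral_enorm_sub_le_add {α : Type*} [MeasurableSpace α] {μ : Measure α} (b : α → ℝ)
    (S : Set α) (u v : ℝ) : ∫⁻ y in S, ‖b y - v‖ₑ ∂μ ≤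
      ∫⁻ y in S, ‖b y - u‖ₑ ∂μ + ‖u - v‖ₑ * μ S := by
  rw [← setLIntegral_const, ← lintegral_add_right _ measurable_const]
  refine lintegral_mono fun y => ?_
  rw [← sub_add_sub_cancel (b y) u v]
  exact enorm_add_le _ _

/-- The passage from the grid to cubes centred at `x`: the cube defining the mean of the level-`m`
cell of `x` lies in the cube about `x` of twice its size. -/
lemma enorm_cubeMean_sub_gridMean_le {b : EuclideanSpace ℝ (Fin n) → ℝ}
    (hb : AEMeasurable b volume) {ρ : ℝ} (hρ : 0 < ρ) (m : ℕ) (x : EuclideanSpace ℝ (Fin n)) :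
    ‖cubeMean b x (2 * gridSide ρ m) - gridMean b ρ 0 0‖ₑ ≤
      (1 + 2 ^ n) * bmoSeminorm b + gridDeviation b ρ x := by
  have hs := gridSide_pos hρ m
  rw [← sub_add_sub_cancel _ (gridMean b ρ m (gridLabel ρ m x)) _]
  refine (enorm_add_le _ _).trans (add_le_add ?_ ?_)
  · rw [enorm_sub_rev, ← ENNReal.ofReal_ofNat 2]
    refine enorm_cubeMean_sub_cubeMean_le hb hs (by positivity) (cube_subset_cube fun i => ?_) le_rfl
    have := gridLabel_preimage_subset_cube hρ m (gridLabel ρ m x) rfl i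
    rw [abs_sub_comm]
    linarith
  · exact le_iSup (fun k => ‖gridMean b ρ k (gridLabel ρ k x) - gridMean b ρ 0 0‖ₑ) m

/-- At the level `m` with `r ≤ gridSide ρ m ≤ 2r`, the given cube lies in a comparable cube about
`x`, whose mean deviates from the reference mean by at most the grid deviation and a multiple of the
BMO seminorm. -/
lemma lintegral_cube_sub_gridMean_le {b : EuclideanSpace ℝ (Fin n) → ℝ}
    (hb : AEMeasurable b volume) {ρ : ℝ} (hρ : 0 < ρ) {c x : EuclideanSpace ℝ (Fin n)} {r : ℝ}
    (hr : 0 < r) (hrρ : r ≤ ρ) (hx : x ∈ cube c r) :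
    ∫⁻ y in cube c r, ‖b y - gridMean b ρ 0 0‖ₑ ≤
      ((1 + 2 ^ n + 4 ^ n) * bmoSeminorm b + gridDeviation b ρ x) * volume (cube c r) := by
  obtain ⟨m, hm1, hm2⟩ := exists_nat_pow_near (x := 4 * ρ / r) (y := 2)
    (by rw [le_div_iff₀ hr]; linarith) one_lt_two
  rw [le_div_iff₀ hr] at hm1
  rw [div_lt_iff₀ hr] at hm2
  have h1 : r ≤ gridSide ρ m := by
    rw [gridSide, le_div_iff₀ (by positivity)]; linarith
  have h2 : gridSide ρ m ≤ 2 * r := by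
    rw [gridSide, div_le_iff₀ (by positivity)]
    rw [pow_succ] at hm2
    linarith
  have hs := gridSide_pos hρ m
  have hsub : cube c r ⊆ cube x (2 * gridSide ρ m) := by
    refine cube_subset_cube fun i => ?_
    have := hx i
    rw [abs_sub_comm]
    linarith
  calc _ ≤ ∫⁻ y in cube c r, ‖b y - cubeMean b x (2 * gridSide ρ m)‖ₑ ∂volume +
        ‖cubeMean b x (2 * gridSide ρ m) - gridMean b ρ 0 0‖ₑ * volume (cube c r) :=
        lintegral_enorm_sub_le_add b _ _ _
    _ ≤ 4 ^ n * bmoSeminorm b * volume (cube c r) +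
        ((1 + 2 ^ n) * bmoSeminorm b + gridDeviation b ρ x) * volume (cube c r) := by
        gcongr
        · refine lintegral_sub_cubeMean_le_of_subset b (by positivity) hsub ?_
          rw [← ENNReal.ofReal_ofNat 4]
          exact volume_cube_le_mul hr (by positivity) (by linarith)
        · exact enorm_cubeMean_sub_gridMean_le hb hρ m x
    _ = _ := by ring

lemma two_pow_eq_ofReal_pow (n : ℕ) : (2 : ℝ≥0∞) ^ n = ENNReal.ofReal 2 ^ n := by
  rw [ENNReal.ofReal_ofNat]

lemma enorm_cubeMean_zero_zpow_sub_le {b : EuclideanSpace ℝ (Fin n) → ℝ}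
    (hb : AEMeasurable b volume) {ρ : ℝ} (hρ : 0 < ρ) (l : ℤ) (k : ℕ) :
    ‖cubeMean b 0 (ρ * 2 ^ l) - cubeMean b 0 (ρ * 2 ^ (l + k))‖ₑ ≤
      k * ((1 + 2 ^ n) * bmoSeminorm b) := by
  induction k with
  | zero => simp
  | succ k ih =>
    rw [← sub_add_sub_cancel _ (cubeMean b 0 (ρ * 2 ^ (l + k))) _]
    refine (enorm_add_le _ _).trans ?_
    push_cast
    rw [add_mul, one_mul]
    refine add_le_add ih ?_
    have e : ρ * 2 ^ (l + (k + 1)) = 2 * (ρ * 2 ^ (l + k)) := by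
      rw [← add_assoc, zpow_add_one₀ two_ne_zero]; ring
    rw [e, two_pow_eq_ofReal_pow]
    have hpos : 0 < ρ * 2 ^ (l + k) := by positivity
    refine enorm_cubeMean_sub_cubeMean_le hb hpos (by positivity)
      (cube_subset_cube fun i => ?_) le_rfl
    simp only [sub_self, abs_zero]
    linarith

/-- Telescoping through centred dyadic cubes costs one multiple of the seminorm per doubling, hence
the growth linear in `|l|`. -/
lemma lintegral_cube_zero_sub_gridMean_le {b : EuclideanSpace ℝ (Fin n) → ℝ}
    (hb : AEMeasurable b volume) {ρ : ℝ} (hρ : 0 < ρ) (l : ℤ) :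
    ∫⁻ y in cube 0 (ρ * 2 ^ l), ‖b y - gridMean b ρ 0 0‖ₑ ≤
      5 * ((1 + 2 ^ n) * bmoSeminorm b) * (1 + (l.natAbs : ℝ≥0∞)) *
        volume (cube (0 : EuclideanSpace ℝ (Fin n)) (ρ * 2 ^ l)) := by
  set γ := (1 + 2 ^ n) * bmoSeminorm b with hγ
  have hpos : 0 < ρ * 2 ^ l := by positivity
  have h1 : ‖cubeMean b 0 (ρ * 2 ^ l) - cubeMean b 0 (ρ * 2 ^ (3 : ℤ))‖ₑ ≤
      ((l - 3).natAbs : ℝ≥0∞) * γ := by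
    rcases le_total l 3 with h | h
    · have h2 := enorm_cubeMean_zero_zpow_sub_le hb hρ l (3 - l).toNat
      rw [Int.toNat_of_nonneg (by omega), add_sub_cancel] at h2
      have e : (l - 3).natAbs = (3 - l).toNat := by omega
      rwa [e]
    · have h2 := enorm_cubeMean_zero_zpow_sub_le hb hρ 3 (l - 3).toNat
      rw [Int.toNat_of_nonneg (by omega), add_sub_cancel, enorm_sub_rev] at h2
      have e : (l - 3).natAbs = (l - 3).toNat := by omega
      rwa [e]
  -- Level `3` is the pivot because the reference cube, centred at `(-2ρ, …, -2ρ)` with half-side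
  -- `4ρ`, reaches coordinates of size `6ρ` and so fits into the centred cube of half-side `8ρ`.
  have h2 : ‖cubeMean b 0 (ρ * 2 ^ (3 : ℤ)) - gridMean b ρ 0 0‖ₑ ≤ γ := by
    rw [enorm_sub_rev, hγ, two_pow_eq_ofReal_pow]
    refine enorm_cubeMean_sub_cubeMean_le hb (gridSide_pos hρ 0) (by positivity)
      (cube_subset_cube fun i => ?_) ?_
    · simp only [gridCorner, gridSide, Pi.zero_apply, Int.cast_zero, mul_zero, zero_sub, pow_zero,
        div_one, PiLp.zero_apply, sub_zero, abs_neg]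
      rw [abs_of_pos (by positivity)]
      norm_num
      linarith
    · simp only [gridSide]
      norm_num
      linarith
  calc _ ≤ ∫⁻ y in cube 0 (ρ * 2 ^ l), ‖b y - cubeMean b 0 (ρ * 2 ^ l)‖ₑ ∂volume +
        ‖cubeMean b 0 (ρ * 2 ^ l) - gridMean b ρ 0 0‖ₑ *
          volume (cube (0 : EuclideanSpace ℝ (Fin n)) (ρ * 2 ^ l)) :=
        lintegral_enorm_sub_le_add b _ _ _
    _ ≤ γ * volume (cube (0 : EuclideanSpace ℝ (Fin n)) (ρ * 2 ^ l)) +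
        (((l - 3).natAbs : ℝ≥0∞) * γ + γ) *
          volume (cube (0 : EuclideanSpace ℝ (Fin n)) (ρ * 2 ^ l)) := by
        gcongr
        · refine (lintegral_sub_cubeMean_le b 0 hpos).trans ?_
          gcongr
          calc bmoSeminorm b = 1 * bmoSeminorm b := (one_mul _).symm
            _ ≤ γ := by rw [hγ]; gcongr; exact le_self_add
        · rw [← sub_add_sub_cancel _ (cubeMean b 0 (ρ * 2 ^ (3 : ℤ))) _]
          exact (enorm_add_le _ _).trans (add_le_add h1 h2)
    _ = (((l - 3).natAbs + 2 : ℕ) : ℝ≥0∞) * γ *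
          volume (cube (0 : EuclideanSpace ℝ (Fin n)) (ρ * 2 ^ l)) := by
        push_cast; ring
    _ ≤ ((5 * (1 + l.natAbs) : ℕ) : ℝ≥0∞) * γ *
          volume (cube (0 : EuclideanSpace ℝ (Fin n)) (ρ * 2 ^ l)) := by
        gcongr
        omega
    _ = _ := by push_cast; ring

/-- At a Lebesgue point, `b x` is within `1` of `b` on average over a small ball, whose comparison
with a cube about `x` leads back to the grid. The exceptional null set does not depend on `ρ`, as is
needed when `ρ` varies with the annulus. -/
lemma ae_enorm_sub_gridMean_le [Nontrivial (EuclideanSpace ℝ (Fin n))]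
    {b : EuclideanSpace ℝ (Fin n) → ℝ} (hb : LocallyIntegrable b) :
    ∀ᵐ x, ∀ ρ : ℝ, 0 < ρ → ‖b x - gridMean b ρ 0 0‖ₑ ≤
      1 + (1 + 2 ^ n + 4 ^ n * (volume (Metric.ball (0 : EuclideanSpace ℝ (Fin n)) 1))⁻¹) *
        bmoSeminorm b + gridDeviation b ρ x := by
  set V := volume (Metric.ball (0 : EuclideanSpace ℝ (Fin n)) 1)
  have hV0 : V ≠ 0 := (Metric.measure_ball_pos _ _ one_pos).ne'
  have hVT : V ≠ ∞ := measure_ball_lt_top.ne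
  have hbm : AEMeasurable b volume := hb.aestronglyMeasurable.aemeasurable
  filter_upwards [IsUnifLocDoublingMeasure.ae_tendsto_average_norm_sub volume hb 1] with x hx ρ hρ
  have hs : Filter.Tendsto (gridSide ρ) Filter.atTop (nhdsWithin 0 (Set.Ioi 0)) := by
    refine tendsto_nhdsWithin_iff.2 ⟨?_, Filter.Eventually.of_forall fun m => gridSide_pos hρ m⟩
    have h1 := (tendsto_pow_atTop_nhds_zero_of_lt_one (r := (1 / 2 : ℝ)) (by norm_num)
      (by norm_num)).const_mul (4 * ρ)
    rw [mul_zero] at h1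
    refine h1.congr fun m => ?_
    rw [gridSide, div_pow, one_pow, mul_one_div]
  have hlim := hx (fun _ => x) (gridSide ρ) hs (Filter.Eventually.of_forall fun m =>
    Metric.mem_closedBall_self (by linarith [gridSide_pos hρ m]))
  obtain ⟨m, hm⟩ := (hlim.eventually (gt_mem_nhds one_pos)).exists
  have hsm := gridSide_pos hρ m
  set S := Metric.closedBall x (gridSide ρ m) with hS
  have hST : volume S ≠ ∞ := measure_closedBall_lt_top.ne
  have hS0 : volume S ≠ 0 := (Metric.measure_closedBall_pos _ _ hsm).ne'
  have hint : IntegrableOn (fun y => b y - b x) S volume :=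
    (hb.integrableOn_isCompact (isCompact_closedBall _ _)).sub
      (integrableOn_const hST)
  have h1 : ∫⁻ y in S, ‖b y - b x‖ₑ ≤ 1 * volume S := by
    rw [setAverage_eq, smul_eq_mul, measureReal_def, inv_mul_lt_iff₀ (ENNReal.toReal_pos hS0 hST), mul_one] at hm
    rw [one_mul, ← ofReal_integral_norm_eq_lintegral_enorm hint]
    exact ENNReal.ofReal_le_of_le_toReal hm.le
  have hsub : S ⊆ cube x (2 * gridSide ρ m) := by
    intro y hy i
    have h2 := abs_apply_le_norm (y - x) i
    rw [hS, mem_closedBall_iff_norm] at hy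
    rw [PiLp.sub_apply] at h2
    linarith
  have hvol : volume (cube x (2 * gridSide ρ m)) ≤ 4 ^ n * V⁻¹ * volume S := by
    calc volume (cube x (2 * gridSide ρ m)) = 4 ^ n * ENNReal.ofReal (gridSide ρ m ^ n) := by
          rw [volume_cube x (by positivity), ← mul_assoc, ENNReal.ofReal_mul (by norm_num), mul_pow,
            ENNReal.ofReal_pow hsm.le]
          norm_num
      _ = 4 ^ n * V⁻¹ * volume (Metric.ball x (gridSide ρ m)) := by
          have e : ∀ A : ℝ≥0∞, 4 ^ n * V⁻¹ * (A * V) = 4 ^ n * A * (V⁻¹ * V) := fun A => by ring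
          rw [volume_ball_eq x hsm.le, e, ENNReal.inv_mul_cancel hV0 hVT, mul_one]
      _ ≤ _ := by
          gcongr
          exact Metric.ball_subset_closedBall
  have h2 := lintegral_sub_cubeMean_le_of_subset b (by positivity) hsub hvol
  have h3 := enorm_sub_le_of_lintegral_le hbm hS0 hST h1 h2
  rw [← sub_add_sub_cancel _ (cubeMean b x (2 * gridSide ρ m)) _]
  calc _ ≤ (1 + 4 ^ n * V⁻¹ * bmoSeminorm b) +
        ((1 + 2 ^ n) * bmoSeminorm b + gridDeviation b ρ x) :=
        (enorm_add_le _ _).trans (add_le_add h3 (enorm_cubeMean_sub_gridMean_le hbm hρ m x))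
    _ = _ := by ring

end DyadicGrid

/-! ### Elementary properties of the Morrey norm -/

section MorreySpace

variable {n : ℕ}

lemma morreyNorm_le_mul {ε ε' : Type*} [ENorm ε] [ENorm ε'] (lam : ℝ)
    {f : EuclideanSpace ℝ (Fin n) → ε} {g : EuclideanSpace ℝ (Fin n) → ε'} {κ : ℝ≥0∞}
    (hκ : κ ≠ ∞) (h : ∀ᵐ x, ‖f x‖ₑ ≤ κ * ‖g x‖ₑ) : morreyNorm lam f ≤ κ * morreyNorm lam g := by
  refine iSup_le fun x => iSup_le fun r => iSup_le fun hr => ?_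
  calc _ ≤ ENNReal.ofReal (r ^ (lam - n)) * ∫⁻ y in Metric.ball x r, κ * ‖g y‖ₑ :=
        mul_le_mul' le_rfl (lintegral_mono_ae (ae_restrict_of_ae h))
    _ = κ * (ENNReal.ofReal (r ^ (lam - n)) * ∫⁻ y in Metric.ball x r, ‖g y‖ₑ) := by
        rw [lintegral_const_mul' _ _ hκ]; ring
    _ ≤ _ := mul_le_mul' le_rfl (lintegral_ball_le_of_morreyNorm lam g x hr)

lemma morreyNorm_add_le (lam : ℝ) (f : EuclideanSpace ℝ (Fin n) → ℝ≥0∞)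
    {g : EuclideanSpace ℝ (Fin n) → ℝ≥0∞} (hg : Measurable g) :
    morreyNorm lam (fun x => f x + g x) ≤ morreyNorm lam f + morreyNorm lam g := by
  refine iSup_le fun x => iSup_le fun r => iSup_le fun hr => ?_
  simp only [enorm_eq_self]
  rw [lintegral_add_right _ hg, mul_add]
  exact add_le_add (lintegral_ball_le_of_morreyNorm lam f x hr)
    (lintegral_ball_le_of_morreyNorm lam g x hr)

lemma lintegral_ball_lt_top_of_morreyNorm {ε : Type*} [ENorm ε] {lam : ℝ}
    {f : EuclideanSpace ℝ (Fin n) → ε} (hf : morreyNorm lam f < ∞)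
    (x : EuclideanSpace ℝ (Fin n)) {r : ℝ} (hr : 0 < r) :
    ∫⁻ y in Metric.ball x r, ‖f y‖ₑ < ∞ := by
  have h := (lintegral_ball_le_of_morreyNorm lam f x hr).trans_lt hf
  refine lt_top_iff_ne_top.2 fun htop => ?_
  rw [htop, ENNReal.mul_top (by simpa using Real.rpow_pos_of_pos hr _)] at h
  exact lt_irrefl _ h

lemma locallyIntegrable_of_morreyNorm {ε : Type*} [TopologicalSpace ε] [ContinuousENorm ε]
    {lam : ℝ} {f : EuclideanSpace ℝ (Fin n) → ε} (hm : AEStronglyMeasurable f volume)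
    (hf : morreyNorm lam f < ∞) : LocallyIntegrable f := fun x =>
  ⟨Metric.ball x 1, Metric.ball_mem_nhds x one_pos, hm.restrict,
    lintegral_ball_lt_top_of_morreyNorm hf x one_pos⟩

lemma ae_lt_top_of_morreyNorm {lam : ℝ} {f : EuclideanSpace ℝ (Fin n) → ℝ≥0∞}
    (hm : AEMeasurable f volume) (hf : morreyNorm lam f < ∞) : ∀ᵐ x, f x < ∞ := by
  have h : ∀ k : ℕ, ∀ᵐ x, x ∈ Metric.ball (0 : EuclideanSpace ℝ (Fin n)) (k + 1) → f x < ∞ := by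
    intro k
    rw [← ae_restrict_iff' measurableSet_ball]
    exact ae_lt_top' hm.restrict
      (lintegral_ball_lt_top_of_morreyNorm hf 0 (by positivity : (0 : ℝ) < k + 1)).ne
  filter_upwards [ae_all_iff.2 h] with x hx
  obtain ⟨k, hk⟩ := exists_nat_gt ‖x‖
  exact hx k (by rw [mem_ball_zero_iff]; linarith)

end MorreySpace

/-! ### Measurability of the maximal operators -/

section Measurability

variable {n : ℕ}

lemma lowerSemicontinuous_iSup_mem {X : Type*} [TopologicalSpace X] {U : Set X} (hU : IsOpen U)
    {F : X → ℝ≥0∞} (hF : Continuous F) : LowerSemicontinuous fun x => ⨆ _ : x ∈ U, F x := by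
  intro x t ht
  by_cases hx : x ∈ U
  · simp only [hx, iSup_pos] at ht
    filter_upwards [hU.mem_nhds hx, hF.continuousAt.eventually (lt_mem_nhds ht)] with z hz hz2
    simpa only [hz, iSup_pos] using hz2
  · simp only [hx, iSup_false] at ht
    exact absurd ht not_lt_bot

lemma measurable_maximalFunction (f : EuclideanSpace ℝ (Fin n) → ℝ) :
    Measurable (maximalFunction f) := by
  refine LowerSemicontinuous.measurable ?_
  unfold maximalFunction
  exact lowerSemicontinuous_iSup fun c => lowerSemicontinuous_iSup fun r =>
    lowerSemicontinuous_iSup fun _ =>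
      lowerSemicontinuous_iSup_mem (isOpen_cube c r) continuous_const

lemma lintegral_cube_lt_top {f : EuclideanSpace ℝ (Fin n) → ℝ} (hf : LocallyIntegrable f)
    (c : EuclideanSpace ℝ (Fin n)) {r : ℝ} (hr : 0 < r) : ∫⁻ y in cube c r, ‖f y‖ₑ < ∞ := by
  have hsub : cube c r ⊆ Metric.closedBall c (n * r) := by
    intro y hy
    rw [mem_closedBall_iff_norm]
    exact norm_le_mul_of_abs_le _ hr.le fun i => (hy i).le
  exact ((hf.integrableOn_isCompact (isCompact_closedBall _ _)).mono_set hsub).2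

/-- The dependence on `β` is Lipschitz, with the mean of `|f|` over the cube as constant. -/
lemma continuous_setLAverage_sub_mul {b f : EuclideanSpace ℝ (Fin n) → ℝ}
    (hf : LocallyIntegrable f) (c : EuclideanSpace ℝ (Fin n)) {r : ℝ} (hr : 0 < r) :
    Continuous fun β : ℝ => ⨍⁻ y in cube c r, ‖β - b y‖ₑ * ‖f y‖ₑ ∂volume := by
  refine continuous_of_le_add_edist (⨍⁻ y in cube c r, ‖f y‖ₑ ∂volume) ?_ fun β β' => ?_
  · rw [setLAverage_eq]
    exact ENNReal.div_ne_top (lintegral_cube_lt_top hf c hr).ne (volume_cube_ne_zero c hr)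
  · simp only [setLAverage_eq]
    rw [ENNReal.mul_comm_div, mul_div_assoc', mul_comm _ (edist β β'),
      ENNReal.div_add_div_same]
    gcongr
    rw [← lintegral_const_mul' _ _ (edist_ne_top _ _),
      ← lintegral_add_right' _ (hf.aestronglyMeasurable.enorm.restrict.const_mul _)]
    refine lintegral_mono fun y => ?_
    simp only
    rw [← add_mul]
    gcongr
    rw [edist_eq_enorm_sub, add_comm, ← sub_add_sub_cancel β β' (b y)]
    exact enorm_add_le _ _

/-- `C_b(f)` itself need not be lower semicontinuous, as `b` is merely measurable. Freeing the value
`b x` into an independent variable gives a jointly lower semicontinuous function, and `C_b(f)` is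
its composition with `x ↦ (b x, x)`. -/
lemma lowerSemicontinuous_maximalCommutator_uncurry {b f : EuclideanSpace ℝ (Fin n) → ℝ}
    (hf : LocallyIntegrable f) : LowerSemicontinuous fun q : ℝ × EuclideanSpace ℝ (Fin n) =>
      ⨆ (c : EuclideanSpace ℝ (Fin n)) (r : ℝ) (_ : 0 < r) (_ : q.2 ∈ cube c r),
        ⨍⁻ y in cube c r, ‖q.1 - b y‖ₑ * ‖f y‖ₑ ∂volume := by
  refine lowerSemicontinuous_iSup fun c => lowerSemicontinuous_iSup fun r =>
    lowerSemicontinuous_iSup fun hr => ?_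
  exact lowerSemicontinuous_iSup_mem (U := {q : ℝ × EuclideanSpace ℝ (Fin n) | q.2 ∈ cube c r})
    (F := fun q => ⨍⁻ y in cube c r, ‖q.1 - b y‖ₑ * ‖f y‖ₑ ∂volume)
    ((isOpen_cube c r).preimage continuous_snd)
    ((continuous_setLAverage_sub_mul hf c hr).comp continuous_fst)

lemma aemeasurable_maximalCommutator {b f : EuclideanSpace ℝ (Fin n) → ℝ}
    (hb : AEMeasurable b volume) (hf : LocallyIntegrable f) :
    AEMeasurable (maximalCommutator b f) volume := by
  have h2 : AEMeasurable (fun x => (b x, x)) (volume : Measure (EuclideanSpace ℝ (Fin n))) :=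
    hb.prodMk aemeasurable_id
  have h3 : Measurable _ :=
    LowerSemicontinuous.measurable (lowerSemicontinuous_maximalCommutator_uncurry (b := b) hf)
  have h4 := h3.comp_aemeasurable h2
  unfold maximalCommutator
  simpa only [Function.comp_def] using h4

end Measurability

/-! ### Pointwise comparison of `M`, `C_b` and `[M, b]` -/

section PointwiseBounds

variable {n : ℕ}

lemma setLAverage_le_maximalFunction (f : EuclideanSpace ℝ (Fin n) → ℝ)
    {c x : EuclideanSpace ℝ (Fin n)} {r : ℝ} (hr : 0 < r) (hx : x ∈ cube c r) :
    ⨍⁻ y in cube c r, ‖f y‖ₑ ∂volume ≤ maximalFunction f x :=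
  le_iSup_of_le c (le_iSup_of_le r (le_iSup_of_le hr (le_iSup_of_le hx le_rfl)))

lemma setLAverage_le_maximalCommutator (b f : EuclideanSpace ℝ (Fin n) → ℝ)
    {c x : EuclideanSpace ℝ (Fin n)} {r : ℝ} (hr : 0 < r) (hx : x ∈ cube c r) :
    ⨍⁻ y in cube c r, ‖b x - b y‖ₑ * ‖f y‖ₑ ∂volume ≤ maximalCommutator b f x :=
  le_iSup_of_le c (le_iSup_of_le r (le_iSup_of_le hr (le_iSup_of_le hx le_rfl)))

lemma maximalFunction_le_mul {f g : EuclideanSpace ℝ (Fin n) → ℝ} {κ : ℝ≥0∞} (hκ : κ ≠ ∞)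
    (h : ∀ᵐ y, ‖f y‖ₑ ≤ κ * ‖g y‖ₑ) (x : EuclideanSpace ℝ (Fin n)) :
    maximalFunction f x ≤ κ * maximalFunction g x := by
  refine iSup_le fun c => iSup_le fun r => iSup_le fun hr => iSup_le fun hx => ?_
  refine le_trans ?_ (mul_le_mul' le_rfl (setLAverage_le_maximalFunction g hr hx))
  rw [setLAverage_eq, setLAverage_eq, ← mul_div_assoc, ← lintegral_const_mul' _ _ hκ]
  exact ENNReal.div_le_div_right (lintegral_mono_ae (ae_restrict_of_ae h)) _

lemma maximalCommutator_le_mul (b : EuclideanSpace ℝ (Fin n) → ℝ)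
    {f g : EuclideanSpace ℝ (Fin n) → ℝ} {κ : ℝ≥0∞} (hκ : κ ≠ ∞)
    (h : ∀ᵐ y, ‖f y‖ₑ ≤ κ * ‖g y‖ₑ) (x : EuclideanSpace ℝ (Fin n)) :
    maximalCommutator b f x ≤ κ * maximalCommutator b g x := by
  refine iSup_le fun c => iSup_le fun r => iSup_le fun hr => iSup_le fun hx => ?_
  refine le_trans ?_ (mul_le_mul' le_rfl (setLAverage_le_maximalCommutator b g hr hx))
  rw [setLAverage_eq, setLAverage_eq, ← mul_div_assoc, ← lintegral_const_mul' _ _ hκ]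
  refine ENNReal.div_le_div_right (lintegral_mono_ae (ae_restrict_of_ae ?_)) _
  filter_upwards [h] with y hy
  calc _ ≤ ‖b x - b y‖ₑ * (κ * ‖g y‖ₑ) := mul_le_mul' le_rfl hy
    _ = _ := by ring

lemma maximalFunction_mul_le {b f : EuclideanSpace ℝ (Fin n) → ℝ}
    (hf : AEMeasurable f volume) (x : EuclideanSpace ℝ (Fin n)) :
    maximalFunction (fun y => b y * f y) x ≤
      maximalCommutator b f x + ‖b x‖ₑ * maximalFunction f x := by
  refine iSup_le fun c => iSup_le fun r => iSup_le fun hr => iSup_le fun hx => ?_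
  refine le_trans ?_ (add_le_add (setLAverage_le_maximalCommutator b f hr hx)
    (mul_le_mul' le_rfl (setLAverage_le_maximalFunction f hr hx)))
  simp only [setLAverage_eq]
  rw [← mul_div_assoc, ENNReal.div_add_div_same, ← lintegral_const_mul' _ _ enorm_ne_top,
    ← lintegral_add_right' _ (hf.enorm.restrict.const_mul _)]
  refine ENNReal.div_le_div_right (lintegral_mono fun y => ?_) _
  rw [← add_mul, enorm_mul]
  gcongr
  calc ‖b y‖ₑ = ‖b x - (b x - b y)‖ₑ := by rw [sub_sub_cancel]
    _ ≤ ‖b x‖ₑ + ‖b x - b y‖ₑ := enorm_sub_le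
    _ = _ := add_comm _ _

lemma enorm_mul_maximalFunction_le {b f : EuclideanSpace ℝ (Fin n) → ℝ}
    (hb : AEMeasurable b volume) (hf : AEMeasurable f volume) (x : EuclideanSpace ℝ (Fin n)) :
    ‖b x‖ₑ * maximalFunction f x ≤
      maximalCommutator b f x + maximalFunction (fun y => b y * f y) x := by
  unfold maximalFunction
  simp only [ENNReal.mul_iSup]
  refine iSup_le fun c => iSup_le fun r => iSup_le fun hr => iSup_le fun hx => ?_
  refine le_trans ?_ (add_le_add (setLAverage_le_maximalCommutator b f hr hx)
    (setLAverage_le_maximalFunction (fun y => b y * f y) hr hx))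
  simp only [setLAverage_eq]
  rw [← mul_div_assoc, ENNReal.div_add_div_same, ← lintegral_const_mul' _ _ enorm_ne_top,
    ← lintegral_add_right' _ (hb.fun_mul hf).enorm.restrict]
  refine ENNReal.div_le_div_right (lintegral_mono fun y => ?_) _
  rw [enorm_mul, ← add_mul]
  gcongr
  calc ‖b x‖ₑ = ‖(b x - b y) + b y‖ₑ := by rw [sub_add_cancel]
    _ ≤ _ := enorm_add_le _ _

/-- The commutator `[M, b]` is controlled by the maximal commutator and the negative part of `b`. -/
lemma enorm_commutatorOfMaximal_le {b f : EuclideanSpace ℝ (Fin n) → ℝ}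
    (hb : AEMeasurable b volume) (hf : AEMeasurable f volume) {x : EuclideanSpace ℝ (Fin n)}
    (hM : maximalFunction f x ≠ ∞) (hC : maximalCommutator b f x ≠ ∞) :
    ‖commutatorOfMaximal b f x‖ₑ ≤
      maximalCommutator b f x + 2 * ‖max (-b x) 0‖ₑ * maximalFunction f x := by
  have h1 := maximalFunction_mul_le (b := b) hf x
  have h2 := enorm_mul_maximalFunction_le hb hf x
  have hMb : maximalFunction (fun y => b y * f y) x ≠ ∞ :=
    ne_top_of_le_ne_top (ENNReal.add_ne_top.2 ⟨hC, ENNReal.mul_ne_top enorm_ne_top hM⟩) h1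
  unfold commutatorOfMaximal
  generalize maximalFunction (fun y => b y * f y) x = P at h1 h2 hMb
  generalize maximalFunction f x = A at h1 h2 hM
  generalize maximalCommutator b f x = K at h1 h2 hC
  lift P to ℝ≥0 using hMb
  lift A to ℝ≥0 using hM
  lift K to ℝ≥0 using hC
  simp only [ENNReal.coe_toReal]
  have e1 : ‖b x‖ₑ = ((‖b x‖₊ : ℝ≥0) : ℝ≥0∞) := rfl
  rw [e1] at h1 h2
  have h1' : (P : ℝ) ≤ K + |b x| * A := by exact_mod_cast h1
  have h2' : |b x| * A ≤ (K : ℝ) + P := by exact_mod_cast h2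
  have e2 : ‖max (-b x) 0‖ₑ = ENNReal.ofReal (max (-b x) 0) :=
    Real.enorm_of_nonneg (le_max_right _ _)
  rw [e2, Real.enorm_eq_ofReal_abs, ← ENNReal.ofReal_coe_nnreal, ← ENNReal.ofReal_coe_nnreal,
    ← ENNReal.ofReal_ofNat 2, ← ENNReal.ofReal_mul (by norm_num), ← ENNReal.ofReal_mul
      (by positivity), ← ENNReal.ofReal_add (by positivity) (by positivity)]
  refine ENNReal.ofReal_le_ofReal ?_
  have hA : (0 : ℝ) ≤ A := A.2
  -- For `b x ≥ 0` the two bounds say `|P - b x * A| ≤ K`. For `b x ≤ 0` the commutator is `P + |b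
  -- x| * A`, at most `K + 2 |b x| * A`; this is where `b⁻` enters.
  rcases le_total 0 (b x) with hbx | hbx
  · rw [abs_of_nonneg hbx] at h1' h2'
    rw [max_eq_right (by linarith), abs_le]
    constructor <;> linarith
  · rw [abs_of_nonpos hbx] at h1' h2'
    rw [max_eq_left (by linarith), abs_le]
    constructor <;> nlinarith

end PointwiseBounds

/-! ### Finiteness of the Morrey norms for the critical power -/

section CriticalPower

variable {n : ℕ}

lemma enorm_norm_rpow (lam : ℝ) (y : EuclideanSpace ℝ (Fin n)) :
    ‖‖y‖ ^ (-lam)‖ₑ = ENNReal.ofReal (‖y‖ ^ (-lam)) :=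
  Real.enorm_of_nonneg (by positivity)

lemma volume_annulus_le {ρ : ℝ} (hρ : 0 < ρ) :
    volume (annulus n ρ) ≤ ENNReal.ofReal (4 * ρ) ^ n := by
  have hsub : annulus n ρ ⊆ cube 0 (2 * ρ) := by
    intro x hx i
    rw [PiLp.zero_apply, sub_zero]
    exact (abs_apply_le_norm x i).trans_lt hx.2
  refine (measure_mono hsub).trans_eq ?_
  rw [volume_cube _ (by positivity)]
  congr 2
  ring

/-- If `g` is dominated on each annulus by `ρ ^ (-lam)` times a function whose moments are bounded
by the volume of the annulus, then `g` has finite Morrey norm. -/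
lemma morreyNorm_lt_top_of_le_mul {lam : ℝ} (hlam0 : 0 < lam) (hlamn : lam < n)
    {g : EuclideanSpace ℝ (Fin n) → ℝ≥0∞} {G : ℝ → EuclideanSpace ℝ (Fin n) → ℝ≥0∞} {C : ℝ≥0∞}
    (hC : C ≠ ∞)
    (hg : ∀ᵐ x, ∀ ρ : ℝ, 0 < ρ → x ∈ annulus n ρ →
      g x ≤ C * ENNReal.ofReal (ρ ^ (-lam)) * G ρ x)
    (hG : ∀ p : ℕ, ∃ D : ℝ≥0∞, D ≠ ∞ ∧ ∀ ρ : ℝ, 0 < ρ →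
      ∫⁻ x in annulus n ρ, G ρ x ^ p ≤ D * ENNReal.ofReal (ρ ^ n)) :
    morreyNorm lam g < ∞ := by
  obtain ⟨q, hq⟩ := exists_nat_gt (n / lam)
  obtain ⟨D, hD, hGD⟩ := hG (q + 1)
  have hq' : n < lam * (q + 1) := by
    rw [div_lt_iff₀ hlam0] at hq
    nlinarith
  obtain ⟨C', hC', H⟩ := exists_morreyNorm_le_of_annulus hlam0 hlamn hq'
    (D := C ^ (q + 1) * D) (by finiteness)
  refine (H g fun ρ hρ => ?_).trans_lt hC'.lt_top
  have hfin : (C * ENNReal.ofReal (ρ ^ (-lam))) ^ (q + 1) ≠ ∞ := by finiteness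
  calc ∫⁻ x in annulus n ρ, g x ^ (q + 1)
      ≤ ∫⁻ x in annulus n ρ, (C * ENNReal.ofReal (ρ ^ (-lam))) ^ (q + 1) * G ρ x ^ (q + 1) := by
        refine lintegral_mono_ae ?_
        filter_upwards [ae_restrict_mem (measurableSet_annulus ρ), ae_restrict_of_ae hg]
          with x hx hgx
        rw [← mul_pow]
        exact pow_le_pow_left' (hgx ρ hρ hx) _
    _ = (C * ENNReal.ofReal (ρ ^ (-lam))) ^ (q + 1) * ∫⁻ x in annulus n ρ, G ρ x ^ (q + 1) :=
        lintegral_const_mul' _ _ hfin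
    _ ≤ (C * ENNReal.ofReal (ρ ^ (-lam))) ^ (q + 1) * (D * ENNReal.ofReal (ρ ^ n)) := by
        gcongr
        exact hGD ρ hρ
    _ = C ^ (q + 1) * D * ENNReal.ofReal ((ρ ^ (-lam)) ^ (q + 1) * ρ ^ n) := by
        rw [ENNReal.ofReal_mul (p := (ρ ^ (-lam)) ^ (q + 1)) (by positivity),
          ENNReal.ofReal_pow (p := ρ ^ (-lam)) (by positivity), mul_pow]
        ring
    _ = _ := by
        congr 2
        rw [← Real.rpow_natCast, ← Real.rpow_natCast, ← Real.rpow_mul hρ.le, ← Real.rpow_add hρ]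
        congr 1
        push_cast
        ring

/-- The maximal function of the critical power lies in the Morrey space. -/
theorem morreyNorm_maximalFunction_rpow_lt_top {lam : ℝ} (hlam0 : 0 < lam) (hlamn : lam < n) :
    morreyNorm lam (maximalFunction fun y : EuclideanSpace ℝ (Fin n) => ‖y‖ ^ (-lam)) < ∞ := by
  obtain ⟨C, hC, H⟩ := exists_lintegral_cube_mul_rpow_le (n := n) hlam0 hlamn
  refine morreyNorm_lt_top_of_le_mul hlam0 hlamn (G := fun _ _ => 1) hC ?_ ?_
  · refine Filter.Eventually.of_forall fun x ρ hρ hx => ?_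
    refine iSup_le fun c => iSup_le fun r => iSup_le fun hr => iSup_le fun hxc => ?_
    have h := H ρ hρ x hx.1 hx.2 (fun _ => 1) 1 (fun l => ?_) (fun c r _ _ _ => ?_) c r hr hxc
    · rw [setLAverage_eq]
      refine ENNReal.div_le_of_le_mul ?_
      simpa [enorm_norm_rpow] using h
    · rw [setLIntegral_one, one_mul]
      exact le_mul_of_one_le_left' le_self_add
    · rw [setLIntegral_one, one_mul]
  · refine fun p => ⟨4 ^ n, by finiteness, fun ρ hρ => ?_⟩
    simp only [one_pow]
    rw [setLIntegral_one]
    refine (volume_annulus_le hρ).trans_eq ?_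
    rw [ENNReal.ofReal_mul (by norm_num), mul_pow, ENNReal.ofReal_pow hρ.le, ENNReal.ofReal_ofNat]

/-- The maximal commutator of the critical power lies in the Morrey space. -/
theorem morreyNorm_maximalCommutator_rpow_lt_top {lam : ℝ} (hlam0 : 0 < lam) (hlamn : lam < n)
    {b : EuclideanSpace ℝ (Fin n) → ℝ} (hb : IsBMO b) :
    morreyNorm lam (maximalCommutator b fun y => ‖y‖ ^ (-lam)) < ∞ := by
  have := nontrivial_of_pos_lt hlam0 hlamn
  have hbm : AEMeasurable b volume := hb.1.aestronglyMeasurable.aemeasurable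
  obtain ⟨C, hC, H⟩ := exists_lintegral_cube_mul_rpow_le (n := n) hlam0 hlamn
  set β := bmoSeminorm b with hβ
  have hβT : β ≠ ∞ := hb.2.ne
  set V := volume (Metric.ball (0 : EuclideanSpace ℝ (Fin n)) 1) with hV
  have hV0 : V ≠ 0 := (Metric.measure_ball_pos _ _ one_pos).ne'
  -- A single constant dominating the four bounds used: Lebesgue points, the steps of the grid,
  -- small cubes, and centred cubes. The summand `1` makes it nonzero even when the seminorm
  -- vanishes and covers the additive `1` of the Lebesgue point estimate.
  set δ : ℝ≥0∞ := 1 + ((1 + 2 ^ n + 4 ^ n * V⁻¹) + (2 ^ n + 2 ^ n * 2 ^ n) + (1 + 2 ^ n + 4 ^ n) +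
    5 * (1 + 2 ^ n)) * β with hδ
  have hδ0 : δ ≠ 0 := by simp [hδ]
  have hδT : δ ≠ ∞ := by
    have : V⁻¹ ≠ ∞ := ENNReal.inv_ne_top.2 hV0
    finiteness
  have hsum : ∀ k₁ k₂ k₃ k₄ : ℝ≥0∞, 1 + k₁ * β ≤ 1 + (k₁ + k₂ + k₃ + k₄) * β ∧
      k₂ * β ≤ 1 + (k₁ + k₂ + k₃ + k₄) * β ∧ k₃ * β ≤ 1 + (k₁ + k₂ + k₃ + k₄) * β ∧
      k₄ * β ≤ 1 + (k₁ + k₂ + k₃ + k₄) * β := by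
    intro k₁ k₂ k₃ k₄
    have e : 1 + (k₁ + k₂ + k₃ + k₄) * β = 1 + k₁ * β + k₂ * β + k₃ * β + k₄ * β := by ring
    rw [e]
    exact ⟨le_self_add.trans (le_self_add.trans le_self_add),
      le_add_self.trans (le_self_add.trans le_self_add), le_add_self.trans le_self_add, le_add_self⟩
  obtain ⟨hδ1, hδ2, hδ3, hδ4⟩ := hsum (1 + 2 ^ n + 4 ^ n * V⁻¹) (2 ^ n + 2 ^ n * 2 ^ n)
    (1 + 2 ^ n + 4 ^ n) (5 * (1 + 2 ^ n))
  rw [← hδ] at hδ1 hδ2 hδ3 hδ4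
  rw [mul_assoc] at hδ4
  refine morreyNorm_lt_top_of_le_mul hlam0 hlamn (C := C * 2)
    (G := fun ρ x => δ + gridDeviation b ρ x) (by finiteness) ?_ ?_
  · filter_upwards [ae_enorm_sub_gridMean_le hb.1] with x hbx ρ hρ hx
    set N := gridDeviation b ρ x with hN
    set α := gridMean b ρ 0 0 with hα
    have hbx' : ‖b x - α‖ₑ ≤ δ + N := (hbx ρ hρ).trans (by gcongr)
    have hsplit : ∀ S : Set (EuclideanSpace ℝ (Fin n)),
        ∫⁻ y in S, (‖b x - α‖ₑ + ‖b y - α‖ₑ) =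
          ‖b x - α‖ₑ * volume S + ∫⁻ y in S, ‖b y - α‖ₑ := by
      intro S
      rw [lintegral_add_left measurable_const, setLIntegral_const]
    refine iSup_le fun c => iSup_le fun r => iSup_le fun hr => iSup_le fun hxc => ?_
    -- With `x` fixed, `|b x - b y|` is split around the reference mean `α`, and `|b x - α|` enters
    -- the averaged function as a constant.
    have h := H ρ hρ x hx.1 hx.2 (fun y => ‖b x - α‖ₑ + ‖b y - α‖ₑ) (2 * (δ + N)) (fun l => ?_)
      (fun c r hr hrρ hxc => ?_) c r hr hxc
    · rw [setLAverage_eq]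
      refine ENNReal.div_le_of_le_mul ?_
      calc _ ≤ ∫⁻ y in cube c r, (‖b x - α‖ₑ + ‖b y - α‖ₑ) * ENNReal.ofReal (‖y‖ ^ (-lam)) := by
            refine lintegral_mono fun y => ?_
            simp only [enorm_norm_rpow]
            gcongr
            rw [← sub_sub_sub_cancel_right (b x) (b y) α]
            exact enorm_sub_le
        _ ≤ _ := h
        _ = _ := by ring
    · rw [hsplit]
      set W := volume (cube (0 : EuclideanSpace ℝ (Fin n)) (ρ * 2 ^ l))
      calc _ ≤ (δ + N) * W + δ * (1 + (l.natAbs : ℝ≥0∞)) * W := by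
            refine add_le_add (by gcongr) ((lintegral_cube_zero_sub_gridMean_le hbm hρ l).trans ?_)
            gcongr
        _ ≤ (δ + N) * (1 + (l.natAbs : ℝ≥0∞)) * W + (δ + N) * (1 + (l.natAbs : ℝ≥0∞)) * W := by
            gcongr
            · exact le_mul_of_one_le_right' le_self_add
            · exact le_self_add
        _ = _ := by ring
    · rw [hsplit]
      calc _ ≤ (δ + N) * volume (cube c r) + (δ + N) * volume (cube c r) := by
            refine add_le_add (by gcongr)
              ((lintegral_cube_sub_gridMean_le hbm hρ hr hrρ hxc).trans ?_)
            gcongr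
        _ = _ := by ring
  · intro p
    refine ⟨(∑' j : ℕ, (4 * δ * (j + 2)) ^ p * 2⁻¹ ^ j) * 8 ^ n,
      ENNReal.mul_ne_top (tsum_linear_pow_mul_geometric_ne_top hδT p) (by finiteness),
      fun ρ hρ => ?_⟩
    refine (lintegral_annulus_gridDeviation_pow_le hbm hδ0 hδT hδ2 hρ p).trans_eq ?_
    rw [ENNReal.ofReal_mul (by norm_num), mul_pow, ENNReal.ofReal_pow hρ.le, ENNReal.ofReal_ofNat,
      mul_assoc]

end CriticalPower

/-! ### Reduction to the critical power and conclusion -/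

theorem mainTheorem11 (n : ℕ) (lam : ℝ) (hlam0 : 0 < lam) (hlamn : lam < n)
    (b : EuclideanSpace ℝ (Fin n) → ℝ) (hb : IsBMO b) :
    BoundedOnRadiallyDecreasing lam (maximalCommutator b) ∧
    (MemLp (fun x => max (-b x) 0) ∞ volume →
      (∀ f : EuclideanSpace ℝ (Fin n) → ℝ, RadiallyDecreasing f → InMorrey lam f →
        ∀ᵐ x, maximalFunction f x < ∞ ∧ maximalFunction (fun y => b y * f y) x < ∞) ∧
      BoundedOnRadiallyDecreasing lam (commutatorOfMaximal b)) := by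
  have := nontrivial_of_pos_lt hlam0 hlamn
  have hbm : AEMeasurable b volume := hb.1.aestronglyMeasurable.aemeasurable
  set V := volume (Metric.ball (0 : EuclideanSpace ℝ (Fin n)) 1)
  have hV : V⁻¹ ≠ ∞ := ENNReal.inv_ne_top.2 (Metric.measure_ball_pos _ _ one_pos).ne'
  set w : EuclideanSpace ℝ (Fin n) → ℝ := fun y => ‖y‖ ^ (-lam) with hw
  have hCw : morreyNorm lam (maximalCommutator b w) < ∞ :=
    morreyNorm_maximalCommutator_rpow_lt_top hlam0 hlamn hb
  have hMw : morreyNorm lam (maximalFunction w) < ∞ :=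
    morreyNorm_maximalFunction_rpow_lt_top hlam0 hlamn
  have hdom : ∀ f : EuclideanSpace ℝ (Fin n) → ℝ, RadiallyDecreasing f → InMorrey lam f →
      ∀ᵐ y, ‖f y‖ₑ ≤ V⁻¹ * morreyNorm lam f * ‖w y‖ₑ := by
    intro f hf hfM
    have h0 : ∀ᵐ y : EuclideanSpace ℝ (Fin n), y ≠ 0 :=
      compl_mem_ae_iff.2 (measure_singleton _)
    filter_upwards [h0] with y hy
    rw [hw, enorm_norm_rpow]
    exact hf.enorm_le hlam0 hfM.2 hy
  have hκ : ∀ f : EuclideanSpace ℝ (Fin n) → ℝ, InMorrey lam f → V⁻¹ * morreyNorm lam f ≠ ∞ :=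
    fun f hf => ENNReal.mul_ne_top hV hf.2.ne
  have hCnorm : ∀ f : EuclideanSpace ℝ (Fin n) → ℝ, RadiallyDecreasing f → InMorrey lam f →
      morreyNorm lam (maximalCommutator b f) ≤
        V⁻¹ * morreyNorm lam (maximalCommutator b w) * morreyNorm lam f := by
    intro f hf hfM
    refine (morreyNorm_le_mul (g := maximalCommutator b w) lam (hκ f hfM)
      (Filter.Eventually.of_forall fun x => ?_)).trans_eq (by ring)
    exact maximalCommutator_le_mul b (hκ f hfM) (hdom f hf hfM) x
  have hMnorm : ∀ f : EuclideanSpace ℝ (Fin n) → ℝ, RadiallyDecreasing f → InMorrey lam f →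
      morreyNorm lam (maximalFunction f) ≤
        V⁻¹ * morreyNorm lam (maximalFunction w) * morreyNorm lam f := by
    intro f hf hfM
    refine (morreyNorm_le_mul (g := maximalFunction w) lam (hκ f hfM)
      (Filter.Eventually.of_forall fun x => ?_)).trans_eq (by ring)
    exact maximalFunction_le_mul (hκ f hfM) (hdom f hf hfM) x
  have hC1 : V⁻¹ * morreyNorm lam (maximalCommutator b w) ≠ ∞ := ENNReal.mul_ne_top hV hCw.ne
  have hC2 : V⁻¹ * morreyNorm lam (maximalFunction w) ≠ ∞ := ENNReal.mul_ne_top hV hMw.ne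
  have hCm : ∀ f : EuclideanSpace ℝ (Fin n) → ℝ, InMorrey lam f →
      AEMeasurable (maximalCommutator b f) volume :=
    fun f hf => aemeasurable_maximalCommutator hbm hf.1
  have hfin : ∀ f : EuclideanSpace ℝ (Fin n) → ℝ, RadiallyDecreasing f → InMorrey lam f →
      ∀ᵐ x, maximalFunction f x < ∞ ∧ maximalCommutator b f x < ∞ := by
    intro f hf hfM
    have h1 := ae_lt_top_of_morreyNorm (measurable_maximalFunction f).aemeasurable
      ((hMnorm f hf hfM).trans_lt (ENNReal.mul_lt_top hC2.lt_top hfM.2))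
    have h2 := ae_lt_top_of_morreyNorm (hCm f hfM)
      ((hCnorm f hf hfM).trans_lt (ENNReal.mul_lt_top hC1.lt_top hfM.2))
    filter_upwards [h1, h2] with x h1 h2 using ⟨h1, h2⟩
  refine ⟨⟨(V⁻¹ * morreyNorm lam (maximalCommutator b w)).toNNReal, fun f hf hfM => ?_⟩,
    fun hbneg => ⟨fun f hf hfM => ?_, ?_⟩⟩
  · rw [ENNReal.coe_toNNReal hC1]
    exact ⟨⟨(locallyIntegrable_of_morreyNorm (hCm f hfM).aestronglyMeasurable
      ((hCnorm f hf hfM).trans_lt (ENNReal.mul_lt_top hC1.lt_top hfM.2))),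
      (hCnorm f hf hfM).trans_lt (ENNReal.mul_lt_top hC1.lt_top hfM.2)⟩, hCnorm f hf hfM⟩
  · filter_upwards [hfin f hf hfM] with x hx
    exact ⟨hx.1, (maximalFunction_mul_le hfM.1.aestronglyMeasurable.aemeasurable x).trans_lt
      (ENNReal.add_lt_top.2 ⟨hx.2, ENNReal.mul_lt_top enorm_lt_top hx.1⟩)⟩
  · set B := eLpNormEssSup (fun x => max (-b x) 0) volume with hB
    have hBT : B ≠ ∞ := by
      have := hbneg.2
      rw [eLpNorm_exponent_top] at this
      exact this.ne
    set K := V⁻¹ * morreyNorm lam (maximalCommutator b w) +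
      2 * B * (V⁻¹ * morreyNorm lam (maximalFunction w)) with hK
    have hKT : K ≠ ∞ := by finiteness
    refine ⟨K.toNNReal, fun f hf hfM => ?_⟩
    rw [ENNReal.coe_toNNReal hKT]
    have hfm : AEMeasurable f volume := hfM.1.aestronglyMeasurable.aemeasurable
    have hpt : ∀ᵐ x, ‖commutatorOfMaximal b f x‖ₑ ≤
        1 * ‖maximalCommutator b f x + 2 * B * maximalFunction f x‖ₑ := by
      filter_upwards [hfin f hf hfM, enorm_ae_le_eLpNormEssSup (fun x => max (-b x) 0) volume]
        with x hx hBx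
      rw [one_mul, enorm_eq_self]
      refine (enorm_commutatorOfMaximal_le hbm hfm hx.1.ne hx.2.ne).trans ?_
      gcongr
    have hnorm : morreyNorm lam (commutatorOfMaximal b f) ≤ K * morreyNorm lam f := by
      calc _ ≤ 1 * morreyNorm lam fun x => maximalCommutator b f x + 2 * B * maximalFunction f x :=
            morreyNorm_le_mul lam ENNReal.one_ne_top hpt
        _ ≤ morreyNorm lam (maximalCommutator b f) +
            morreyNorm lam fun x => 2 * B * maximalFunction f x := by
            rw [one_mul]
            exact morreyNorm_add_le lam _ ((measurable_maximalFunction f).const_mul _)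
        _ ≤ V⁻¹ * morreyNorm lam (maximalCommutator b w) * morreyNorm lam f +
            2 * B * (V⁻¹ * morreyNorm lam (maximalFunction w) * morreyNorm lam f) := by
            refine add_le_add (hCnorm f hf hfM) ?_
            refine (morreyNorm_le_mul (g := maximalFunction f) (κ := 2 * B) lam (by finiteness)
              (Filter.Eventually.of_forall fun x => le_rfl)).trans ?_
            exact mul_le_mul' le_rfl (hMnorm f hf hfM)
        _ = _ := by rw [hK]; ring
    have hlt : morreyNorm lam (commutatorOfMaximal b f) < ∞ :=
      hnorm.trans_lt (ENNReal.mul_lt_top hKT.lt_top hfM.2)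
    have hmeas : AEStronglyMeasurable (commutatorOfMaximal b f) volume := by
      unfold commutatorOfMaximal
      exact ((measurable_maximalFunction _).ennreal_toReal.aemeasurable.sub
        (hbm.mul (measurable_maximalFunction f).ennreal_toReal.aemeasurable)).aestronglyMeasurable
    exact ⟨⟨locallyIntegrable_of_morreyNorm hmeas hlt, hlt⟩, hnorm⟩
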